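/- For an integer $k\ge 2$ let $\mathcal D_k$ be the set of probability distributions on $\mathbb N$ all of whose nonzero masses are at least $1/k$, and let $S(P)$ be the number of symbols to which $P$ gives nonzero mass. For $\epsilon>0$ let $n^*(k,\epsilon)$ be the least integer $n\ge 0$ for which there is an integer-valued function $\hat S=\hat S(X_1,\dots,X_n)$ of $n$ samples such that $\mathbb P[|\hat S-S(P)|\ge \epsilon k]\le 0.1$ for every $P\in\mathcal D_k$, where $X_1,\dots,X_n$ are i.i.d. with law $P$. For $0<\epsilon<\frac12$ put $$\delta=\frac{\log\frac1\epsilon}{\log k},\qquad \tau=\frac{\sqrt{\log k}/k^{1/4}}{1-2\epsilon}.$$ (1) As $k\to\infty$, $\delta\to0$ and $\tau\to0$, $$n^*(k,\epsilon)\ \ge\ \bigl(1-o_\delta(1)-o_k(1)-o_\tau(1)\bigr)\,\frac{k}{2e^2\log k}\,\log^2\frac1{2\epsilon}.$$ That is, there are real functions $f,g,h$ (independent of $k$ and $\epsilon$) with $f(\delta)\to0$ as $\delta\to0^+$, $g(k)\to0$ as $k\to\infty$ and $h(\tau)\to0$ as $\tau\to0^+$, such that for all integers $k\ge2$ and all $\epsilon\in(0,\frac12)$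 the inequality holds with $1-f(\delta)-g(k)-h(\tau)$ as the first factor. (2) For all constants $c,c'>0$ there are $C>0$ and $K$, depending only on $c$ and $c'$, such that for all integers $k\ge K$ and all $\epsilon$ with $$\frac1{k^{c}}\le\epsilon\le\frac12-c'\,\frac{\sqrt{\log k}}{k^{1/4}}$$ one has $$n^*(k,\epsilon)\ \ge\ C\,\frac{k}{\log k}\,\log^2\frac1{2\epsilon}.$$ -/

import Mathlib

open Real Filter Topology MeasureTheory

namespace SupportSize

/-- The support size `S(P)`: the number of symbols to which `P` gives nonzero mass. -/
noncomputable def supportSize (P : PMF ℕ) : ℕ := P.support.ncard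

/-- The class `𝒟_k` of the probability distributions on `ℕ` all of whose nonzero masses are at
least `1 / k`. -/
def distClass (k : ℕ) : Set (PMF ℕ) := {P | ∀ i, P i ≠ 0 → 1 / (k : ℝ) ≤ (P i).toReal}

/-- The joint law of `n` independent samples `X_1, …, X_n` drawn from `P`. -/
noncomputable def sampleLaw (P : PMF ℕ) (n : ℕ) : Measure (Fin n → ℕ) :=
  Measure.pi fun _ => P.toMeasure

/-- The integer-valued estimator `Shat`, a function of `n` samples, satisfies
`ℙ[|Shat - S(P)| ≥ ε k] ≤ 0.1` for every `P ∈ 𝒟_k`. -/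
def Succeeds (k : ℕ) (ε : ℝ) (n : ℕ) (Shat : (Fin n → ℕ) → ℤ) : Prop :=
  ∀ P ∈ distClass k,
    (sampleLaw P n).real {x | ε * k ≤ |(Shat x : ℝ) - (supportSize P : ℝ)|} ≤ 0.1

/-- The sample complexity `n^*(k, ε)`: the least number `n ≥ 0` of samples with which some
integer-valued estimator succeeds. (The set is nonempty if `ε > 0`, see
`exists_succeeds`.) -/
noncomputable def sampleComplexity (k : ℕ) (ε : ℝ) : ℕ :=
  sInf {n : ℕ | ∃ Shat : (Fin n → ℕ) → ℤ, Succeeds k ε n Shat}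

theorem card_le_of_mem_distClass {k : ℕ} (hk : 0 < k) {P : PMF ℕ} (hP : P ∈ distClass k)
    (s : Finset ℕ) (hs : ∀ i ∈ s, P i ≠ 0) : s.card ≤ k := by
  have hk' : (0 : ℝ) < k := by exact_mod_cast hk
  have h1 : ∑ i ∈ s, (P i).toReal ≤ 1 := by
    rw [← ENNReal.toReal_sum (fun i _ => P.apply_ne_top i)]
    have : ∑ i ∈ s, P i ≤ 1 := by
      rw [← P.tsum_coe]
      exact ENNReal.sum_le_tsum s
    exact ENNReal.toReal_le_of_le_ofReal zero_le_one (by simpa using this)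
  have h2 : (s.card : ℝ) * (1 / k) ≤ 1 := by
    calc (s.card : ℝ) * (1 / k) = ∑ i ∈ s, (1 / (k : ℝ)) := by simp
      _ ≤ ∑ i ∈ s, (P i).toReal := Finset.sum_le_sum fun i hi => hP i (hs i hi)
      _ ≤ 1 := h1
  have h3 : (s.card : ℝ) ≤ k := by
    rw [mul_one_div, div_le_one hk'] at h2
    exact h2
  exact_mod_cast h3

theorem support_finite {k : ℕ} (hk : 0 < k) {P : PMF ℕ} (hP : P ∈ distClass k) :
    P.support.Finite := by
  by_contra h
  obtain ⟨s, hs, hc⟩ := Set.Infinite.exists_subset_card_eq h (k + 1)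
  have := card_le_of_mem_distClass hk hP s fun i hi => (P.mem_support_iff i).1 (hs hi)
  omega

/-- With enough samples the number of distinct observed symbols is a good estimator, so the
minimum that defines the sample complexity is over a nonempty set. -/
theorem exists_succeeds {k : ℕ} (hk : 0 < k) {ε : ℝ} (hε : 0 < ε) :
    ∃ n : ℕ, ∃ Shat : (Fin n → ℕ) → ℤ, Succeeds k ε n Shat := by
  have hk' : (0 : ℝ) < k := by exact_mod_cast hk
  have hk1 : (1 : ℝ) ≤ k := by exact_mod_cast hk
  have hq0 : 0 ≤ 1 - 1 / (k : ℝ) := by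
    rw [sub_nonneg, div_le_one hk']; exact hk1
  have hq1 : 1 - 1 / (k : ℝ) < 1 := by
    have : 0 < 1 / (k : ℝ) := by positivity
    linarith
  obtain ⟨n, hn⟩ : ∃ n : ℕ, (1 - 1 / (k : ℝ)) ^ n < 0.1 / k :=
    exists_pow_lt_of_lt_one (by positivity) hq1
  refine ⟨n, fun x => ((Finset.univ.image x).card : ℤ), fun P hP => ?_⟩
  have hfin := support_finite hk hP
  set T : Finset ℕ := hfin.toFinset with hT
  have hTmem : ∀ i, i ∈ T ↔ P i ≠ 0 := fun i => by simp [hT, PMF.mem_support_iff]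
  have hTS : supportSize P = T.card := Set.ncard_eq_toFinset_card _ hfin
  have hTk : T.card ≤ k := card_le_of_mem_distClass hk hP T fun i hi => (hTmem i).1 hi
  have : IsProbabilityMeasure (sampleLaw P n) := by unfold sampleLaw; infer_instance
  -- almost surely only symbols of the support are observed
  have hnull : ∀ j : Fin n, sampleLaw P n {x : Fin n → ℕ | x j ∉ T} = 0 := by
    intro j
    have hmp := measurePreserving_eval (fun _ : Fin n => P.toMeasure) j
    have : {x : Fin n → ℕ | x j ∉ T} = (Function.eval j : (Fin n → ℕ) → ℕ) ⁻¹' {i : ℕ | i ∉ T} := rfl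
    rw [sampleLaw, this, hmp.measure_preimage (MeasurableSet.of_discrete).nullMeasurableSet,
      PMF.toMeasure_apply_eq_zero_iff _ MeasurableSet.of_discrete, Set.disjoint_left]
    intro i hi hi'
    exact hi' ((hTmem i).2 ((P.mem_support_iff i).1 hi))
  -- a fixed symbol of the support is missed with small probability
  have hmiss : ∀ i ∈ T, (sampleLaw P n).real {x | ∀ j, x j ≠ i} ≤ 0.1 / k := by
    intro i hi
    have hset : {x : Fin n → ℕ | ∀ j, x j ≠ i} = Set.univ.pi fun _ => {i}ᶜ := by
      ext x; simp
    have h1 : P.toMeasure.real {i}ᶜ = 1 - (P i).toReal := by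
      rw [probReal_compl_eq_one_sub (measurableSet_singleton i), Measure.real,
        P.toMeasure_apply_singleton i (measurableSet_singleton i)]
    have h2 : (sampleLaw P n).real {x | ∀ j, x j ≠ i} = (1 - (P i).toReal) ^ n := by
      rw [hset, sampleLaw, Measure.real, Measure.pi_pi, Finset.prod_const, ENNReal.toReal_pow,
        ← Measure.real, h1, Finset.card_univ, Fintype.card_fin]
    have h3 : 1 / (k : ℝ) ≤ (P i).toReal := hP i ((hTmem i).1 hi)
    have h4 : (0 : ℝ) ≤ 1 - (P i).toReal := by rw [← h1]; exact measureReal_nonneg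
    rw [h2]
    exact (pow_le_pow_left₀ h4 (by linarith) n).trans hn.le
  have hsub : {x : Fin n → ℕ | ε * k ≤
      |((((Finset.univ.image x).card : ℕ) : ℤ) : ℝ) - (supportSize P : ℝ)|} ⊆
      (⋃ j : Fin n, {x : Fin n → ℕ | x j ∉ T}) ∪ ⋃ i ∈ T, {x | ∀ j, x j ≠ i} := by
    intro x hx
    by_contra hcon
    simp only [Set.mem_union, Set.mem_iUnion, Set.mem_ofPred_eq, not_or, not_exists, not_not,
      not_forall] at hcon
    obtain ⟨hc1, hc2⟩ := hcon
    have himg : Finset.univ.image x = T := by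
      ext i
      simp only [Finset.mem_image, Finset.mem_univ, true_and]
      constructor
      · rintro ⟨j, rfl⟩; exact hc1 j
      · intro hi
        exact hc2 i hi
    rw [Set.mem_ofPred_eq, himg, hTS] at hx
    simp only [Int.cast_natCast, sub_self, abs_zero] at hx
    have : 0 < ε * k := by positivity
    linarith
  have hnull' : (sampleLaw P n).real (⋃ j : Fin n, {x : Fin n → ℕ | x j ∉ T}) = 0 := by
    rw [Measure.real, measure_iUnion_null hnull, ENNReal.toReal_zero]
  calc (sampleLaw P n).real _ ≤ (sampleLaw P n).real
        ((⋃ j : Fin n, {x : Fin n → ℕ | x j ∉ T}) ∪ ⋃ i ∈ T, {x | ∀ j, x j ≠ i}) := measureReal_mono hsub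
    _ ≤ (sampleLaw P n).real (⋃ j : Fin n, {x : Fin n → ℕ | x j ∉ T}) +
        (sampleLaw P n).real (⋃ i ∈ T, {x | ∀ j, x j ≠ i}) := measureReal_union_le _ _
    _ ≤ 0 + ∑ i ∈ T, (sampleLaw P n).real {x | ∀ j, x j ≠ i} := by
        rw [hnull']
        gcongr
        exact measureReal_biUnion_finset_le _ _
    _ ≤ 0 + ∑ i ∈ T, 0.1 / (k : ℝ) := by
        gcongr with i hi
        exact hmiss i hi
    _ = T.card * (0.1 / k) := by simp
    _ ≤ k * (0.1 / k) := by gcongr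
    _ = 0.1 := by field_simp

end SupportSize

/-! The bound comes from testing two random mixtures against each other. Write ℓ = log(1/(2ε)) and L
≈ γ log k. There are laws `p`, `q` on {0} ∪ [1, b²] with mean one, equal moments up to order L, and
masses at 0 that differ by at least ((b-1)/(b+1))^L (`exists_moment_matching`). Draw m i.i.d. values
from one of them, with m slightly below k, and normalise. If the total is at most k, the nonzero
masses are at least 1/k. The support size concentrates at m(1-p₀) or m(1-q₀). With b ≈ 1 + 2L/ℓ
these differ by more than 2εk, so a successful estimator tells the mixtures apart.

On the other hand, for a Poisson sample size the counts are independent mixtures of Poisson laws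
with intensities in [0, M], M = λb², λ ≈ n/k. Interpolating each Poisson probability at Chebyshev
nodes bounds the ℓ¹ distance of two such mixtures by 4(M+2)(M/2)^(L+1)/(L+1)!
(`tsum_abs_poisson_mixture_le`), and distances add over the m symbols. The total is small once M ≤
(2/e)e^(-(1+η)/γ) L. To leading order, with ℓ small against L, this allows n ≈ kℓ²/(2eγe^(1/γ) log
k). The choice γ = 1 minimises γe^(1/γ) and produces the constant 2e².

Concentration requires b² to be small against k(2ε(1-2ε))². Near ε = 1/2 this says that log²k/k is
small against (1-2ε)⁴, that is, that τ is small. `not_succeeds` is the testing argument and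
`not_succeeds_of_le` chooses the parameters. The sharp constant uses γ = 1
(`asymptotic_lower_bound`). The uniform bound uses a small γ depending on c'
(`uniform_lower_bound`), and monotonicity in ε covers ε < k^(-1/8). -/

namespace SupportSize

/-! ### Moment matching through a weighted Chebyshev problem -/

section Matching
open Polynomial

/-- The negative factors of the weight come from the n - i nodes to the right of `v i`. -/
theorem nodalWeight_sign {n : ℕ} {v : Fin (n + 1) → ℝ} (hv : StrictMono v) (i : Fin (n + 1)) :
    0 < (-1) ^ (n - i) * Lagrange.nodalWeight Finset.univ v i := by
  have hsplit : Finset.univ.erase i = Finset.Iio i ∪ Finset.Ioi i := by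
    ext j
    simp only [Finset.mem_erase, Finset.mem_univ, and_true, Finset.mem_union, Finset.mem_Iio,
      Finset.mem_Ioi]
    exact ne_iff_lt_or_gt
  have hdisj : Disjoint (Finset.Iio i) (Finset.Ioi i) := by
    rw [Finset.disjoint_left]
    intro j hj hj'
    exact lt_asymm (Finset.mem_Iio.1 hj) (Finset.mem_Ioi.1 hj')
  have h1 : 0 < ∏ j ∈ Finset.Iio i, (v i - v j)⁻¹ :=
    Finset.prod_pos fun j hj => inv_pos.2 (sub_pos.2 (hv (Finset.mem_Iio.1 hj)))
  have h2 : 0 < ∏ j ∈ Finset.Ioi i, ((-1) * (v i - v j)⁻¹) :=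
    Finset.prod_pos fun j hj => by
      have h := inv_lt_zero.2 (sub_neg.2 (hv (Finset.mem_Ioi.1 hj)))
      linarith
  rw [Finset.prod_mul_distrib, Finset.prod_const, Fin.card_Ioi] at h2
  have hc : n + 1 - 1 - (i : ℕ) = n - i := by omega
  rw [hc] at h2
  rw [Lagrange.nodalWeight, hsplit, Finset.prod_union hdisj]
  calc 0 < _ := mul_pos h1 h2
    _ = _ := by ring

/-- The sum is the divided difference at n + 1 nodes, which is the coefficient of Xⁿ. -/
theorem sum_nodalWeight_mul_eval {n : ℕ} {v : Fin (n + 1) → ℝ} (hv : Function.Injective v)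
    {P : ℝ[X]} (hP : P.natDegree < n) :
    ∑ i, Lagrange.nodalWeight Finset.univ v i * P.eval (v i) = 0 := by
  have hdeg : P.degree < ((Finset.univ : Finset (Fin (n + 1))).card : WithBot ℕ) := by
    refine lt_of_le_of_lt degree_le_natDegree ?_
    rw [Finset.card_univ, Fintype.card_fin]
    exact_mod_cast hP.trans (Nat.lt_succ_self n)
  have h := Lagrange.coeff_eq_sum (s := Finset.univ) (v := v) hv.injOn hdeg
  rw [Finset.card_univ, Fintype.card_fin, Nat.add_sub_cancel,
    coeff_eq_zero_of_natDegree_lt hP] at h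
  rw [h]
  refine Finset.sum_congr rfl fun i _ => ?_
  rw [Lagrange.nodalWeight, Finset.prod_inv_distrib, div_eq_mul_inv, mul_comm]

/-- The polynomials `x cos (2 ψ + (n - 1) θ)`, which deviate least from zero with weight `1 / x`
on `[1, b ^ 2]`, relative to their value at `0`. -/
noncomputable def extremalPoly (b : ℝ) : ℕ → ℝ[X]
  | 0 => C ((b ^ 2 + 1) / (b ^ 2 - 1)) * X - C (2 * b ^ 2 / (b ^ 2 - 1))
  | 1 => C (2 / (b - 1) ^ 2) * (X - C b) ^ 2 - X
  | n + 2 => C 2 * (C (2 / (b ^ 2 - 1)) * X - C ((b ^ 2 + 1) / (b ^ 2 - 1))) *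
      extremalPoly b (n + 1) - extremalPoly b n

theorem natDegree_extremalPoly_le (b : ℝ) (n : ℕ) : (extremalPoly b n).natDegree ≤ n + 1 := by
  induction n using Nat.twoStepInduction with
  | zero => rw [extremalPoly]; compute_degree
  | one => rw [extremalPoly]; compute_degree
  | more n ih0 ih1 =>
    rw [extremalPoly]
    have h1 : (C 2 * (C (2 / (b ^ 2 - 1)) * X - C ((b ^ 2 + 1) / (b ^ 2 - 1)))).natDegree ≤ 1 := by
      compute_degree
    have h2 := natDegree_mul_le_of_le h1 ih1
    exact (natDegree_sub_le_of_le h2 ih0).trans (by omega)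

/-- At 0 the recurrence has characteristic roots -(b+1)/(b-1) and its inverse, and the initial
values select the growing one alone. This growth is the separation rate. -/
theorem eval_zero_extremalPoly {b : ℝ} (hb : 1 < b) (n : ℕ) :
    (extremalPoly b n).eval 0 = -(2 * b ^ 2 / (b ^ 2 - 1)) * (-((b + 1) / (b - 1))) ^ n := by
  have h1 : b - 1 ≠ 0 := by linarith
  have h2 : b ^ 2 - 1 ≠ 0 := by nlinarith
  have h3 : b + 1 ≠ 0 := by linarith
  have h4 : b ^ 2 - 1 = (b - 1) * (b + 1) := by ring
  induction n using Nat.twoStepInduction with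
  | zero => simp [extremalPoly]
  | one =>
    simp only [extremalPoly, eval_sub, eval_mul, eval_C, eval_pow, eval_X, pow_one]
    rw [h4]; field_simp; ring
  | more n ih0 ih1 =>
    rw [extremalPoly, eval_sub, eval_mul, ih0, ih1]
    simp only [eval_sub, eval_mul, eval_C, eval_X, mul_zero, zero_sub]
    set c := (-((b + 1) / (b - 1))) ^ n with hc
    rw [pow_succ (-((b + 1) / (b - 1))) (n + 1), pow_succ (-((b + 1) / (b - 1))) n, ← hc, h4]
    field_simp
    ring

/-- The phase ψ in the variable s = √x. Its cosine is not a polynomial in x, but x cos 2ψ is. -/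
noncomputable def firstPhase (b s : ℝ) : ℝ := arccos ((s - b / s) / (b - 1))

/-- The phase θ: its cosine is the affine map of [1, b²] onto [-1, 1] at x = s². -/
noncomputable def secondPhase (b s : ℝ) : ℝ := arccos ((2 * s ^ 2 - b ^ 2 - 1) / (b ^ 2 - 1))

theorem firstPhase_arg_mem {b s : ℝ} (hb : 1 < b) (h1 : 1 ≤ s) (h2 : s ≤ b) :
    -1 ≤ (s - b / s) / (b - 1) ∧ (s - b / s) / (b - 1) ≤ 1 := by
  have hs : 0 < s := by linarith
  have hb1 : 0 < b - 1 := by linarith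
  have e : (s - b / s) / (b - 1) = (s ^ 2 - b) / (s * (b - 1)) := by field_simp
  rw [e, le_div_iff₀ (by positivity), div_le_iff₀ (by positivity)]
  constructor <;> nlinarith

theorem secondPhase_arg_mem {b s : ℝ} (hb : 1 < b) (h1 : 1 ≤ s) (h2 : s ≤ b) :
    -1 ≤ (2 * s ^ 2 - b ^ 2 - 1) / (b ^ 2 - 1) ∧ (2 * s ^ 2 - b ^ 2 - 1) / (b ^ 2 - 1) ≤ 1 := by
  have hb1 : 0 < b ^ 2 - 1 := by nlinarith
  rw [le_div_iff₀ hb1, div_le_iff₀ hb1]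
  constructor <;> nlinarith

/-- The sines of both phases contain the same square root, so x cos(2ψ - θ) is affine in x. After
the two initial cases, the recurrence is cos(A + θ) + cos(A - θ) = 2 cos A cos θ. -/
theorem eval_extremalPoly {b s : ℝ} (hb : 1 < b) (h1 : 1 ≤ s) (h2 : s ≤ b) (n : ℕ) :
    (extremalPoly b n).eval (s ^ 2) =
      s ^ 2 * cos (2 * firstPhase b s + ((n : ℝ) - 1) * secondPhase b s) := by
  have hs : 0 < s := by linarith
  have hb1 : 0 < b - 1 := by linarith
  have hb2 : 0 < b ^ 2 - 1 := by nlinarith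
  obtain ⟨a1, a2⟩ := firstPhase_arg_mem hb h1 h2
  obtain ⟨a3, a4⟩ := secondPhase_arg_mem hb h1 h2
  have hc1 : cos (firstPhase b s) = (s - b / s) / (b - 1) := cos_arccos a1 a2
  have hc2 : cos (secondPhase b s) = (2 * s ^ 2 - b ^ 2 - 1) / (b ^ 2 - 1) := cos_arccos a3 a4
  have hR0 : 0 ≤ (s ^ 2 - 1) * (b ^ 2 - s ^ 2) := mul_nonneg (by nlinarith) (by nlinarith)
  have hs1 : sin (firstPhase b s) = √((s ^ 2 - 1) * (b ^ 2 - s ^ 2)) / (s * (b - 1)) := by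
    rw [firstPhase, sin_arccos, ← sqrt_sq (by positivity : 0 ≤ s * (b - 1)),
      ← sqrt_div hR0]
    congr 1
    field_simp
    ring
  have hs2 : sin (secondPhase b s) = 2 * √((s ^ 2 - 1) * (b ^ 2 - s ^ 2)) / (b ^ 2 - 1) := by
    have e2 := sqrt_mul (by positivity : (0 : ℝ) ≤ 2 ^ 2) ((s ^ 2 - 1) * (b ^ 2 - s ^ 2))
    rw [sqrt_sq (by norm_num)] at e2
    have e3 := sqrt_div (by positivity : 0 ≤ 2 ^ 2 * ((s ^ 2 - 1) * (b ^ 2 - s ^ 2)))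
      ((b ^ 2 - 1) ^ 2)
    rw [sqrt_sq hb2.le] at e3
    rw [secondPhase, sin_arccos, ← e2, ← e3]
    congr 1
    field_simp
    ring
  have hR := mul_self_sqrt hR0
  set R := √((s ^ 2 - 1) * (b ^ 2 - s ^ 2))
  induction n using Nat.twoStepInduction with
  | zero =>
    have e : 2 * firstPhase b s + (((0 : ℕ) : ℝ) - 1) * secondPhase b s =
      2 * firstPhase b s - secondPhase b s := by push_cast; ring
    rw [e, cos_sub, cos_two_mul, sin_two_mul, hc1, hc2, hs1, hs2]
    simp only [extremalPoly, eval_sub, eval_mul, eval_C, eval_X]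
    have e3 : 2 * (R / (s * (b - 1))) * ((s - b / s) / (b - 1)) * (2 * R / (b ^ 2 - 1)) =
      4 * (R * R) * ((s - b / s) / (b - 1)) / ((s * (b - 1)) * (b ^ 2 - 1)) := by
      field_simp
      ring
    rw [e3, hR]
    field_simp
    ring
  | one =>
    have e : 2 * firstPhase b s + (((1 : ℕ) : ℝ) - 1) * secondPhase b s =
      2 * firstPhase b s := by push_cast; ring
    rw [e, cos_two_mul, hc1]
    simp only [extremalPoly, eval_sub, eval_mul, eval_C, eval_X, eval_pow]
    field_simp
  | more n ih0 ih1 =>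
    rw [extremalPoly, eval_sub, eval_mul, ih0, ih1]
    simp only [eval_sub, eval_mul, eval_C, eval_X]
    have e1 : 2 * firstPhase b s + (((n + 2 : ℕ) : ℝ) - 1) * secondPhase b s =
      (2 * firstPhase b s + (((n + 1 : ℕ) : ℝ) - 1) * secondPhase b s) + secondPhase b s := by
      push_cast; ring
    have e2 : 2 * firstPhase b s + ((n : ℝ) - 1) * secondPhase b s =
      (2 * firstPhase b s + (((n + 1 : ℕ) : ℝ) - 1) * secondPhase b s) - secondPhase b s := by
      push_cast; ring
    rw [e1, e2]
    generalize 2 * firstPhase b s + (((n + 1 : ℕ) : ℝ) - 1) * secondPhase b s = A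
    rw [cos_add, cos_sub, hc2]
    field_simp
    ring

/-- The phase 2ψ + mθ decreases continuously from (m+2)π at s = 1 to 0 at s = b, and so takes each
of the m + 3 intermediate multiples of π. -/
theorem exists_alternation {b : ℝ} (hb : 1 < b) (m : ℕ) :
    ∃ y : Fin (m + 3) → ℝ, StrictMono y ∧ (∀ i, 1 ≤ y i ∧ y i ≤ b ^ 2) ∧
      ∀ i, (extremalPoly b (m + 1)).eval (y i) = (-1) ^ (m + 2 - (i : ℕ)) * y i := by
  have hb1 : 0 < b - 1 := by linarith
  have hb2 : 0 < b ^ 2 - 1 := by nlinarith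
  set Φ : ℝ → ℝ := fun s => 2 * firstPhase b s + m * secondPhase b s with hΦ
  have hanti : AntitoneOn Φ (Set.Icc 1 b) := by
    intro s hs t ht hst
    have hs0 : 0 < s := by linarith [hs.1]
    have ht0 : 0 < t := by linarith [ht.1]
    have i1 : firstPhase b t ≤ firstPhase b s := by
      apply antitone_arccos
      apply div_le_div_of_nonneg_right _ hb1.le
      have : b / t ≤ b / s := div_le_div_of_nonneg_left (by linarith) hs0 hst
      linarith
    have i2 : secondPhase b t ≤ secondPhase b s := by
      apply antitone_arccos
      apply div_le_div_of_nonneg_right _ hb2.le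
      nlinarith
    have : (0 : ℝ) ≤ m := Nat.cast_nonneg m
    simp only [hΦ]
    nlinarith
  have hcont : ContinuousOn Φ (Set.Icc 1 b) := by
    have hne : ∀ s ∈ Set.Icc 1 b, s ≠ 0 := fun s hs => by linarith [hs.1]
    simp only [hΦ, firstPhase, secondPhase]
    refine ContinuousOn.add ?_ ?_
    · refine continuousOn_const.mul (continuous_arccos.comp_continuousOn ?_)
      exact (continuousOn_id.sub (continuousOn_const.div continuousOn_id hne)).div_const _
    · refine continuousOn_const.mul (continuous_arccos.comp_continuousOn ?_)
      fun_prop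
  have hΦ1 : Φ 1 = (m + 2) * π := by
    have e1 : (1 - b / 1) / (b - 1) = -1 := by field_simp; ring
    have e2 : (2 * 1 ^ 2 - b ^ 2 - 1) / (b ^ 2 - 1) = -1 := by field_simp; ring
    simp only [hΦ, firstPhase, secondPhase]
    rw [e1, e2, arccos_neg_one]; ring
  have hΦb : Φ b = 0 := by
    have e1 : (b - b / b) / (b - 1) = 1 := by
      have : b ≠ 0 := by linarith
      field_simp
    have e2 : (2 * b ^ 2 - b ^ 2 - 1) / (b ^ 2 - 1) = 1 := by field_simp; ring
    simp only [hΦ, firstPhase, secondPhase]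
    rw [e1, e2, arccos_one]; ring
  have hex : ∀ i : Fin (m + 3), ∃ s ∈ Set.Icc 1 b, Φ s = ((m + 2 - (i : ℕ) : ℕ) : ℝ) * π := by
    intro i
    have := intermediate_value_Icc' hb.le hcont
    obtain ⟨s, hs, h⟩ := this (show ((m + 2 - (i : ℕ) : ℕ) : ℝ) * π ∈ Set.Icc (Φ b) (Φ 1) by
      rw [hΦb, hΦ1]
      refine ⟨by positivity, ?_⟩
      have : ((m + 2 - (i : ℕ) : ℕ) : ℝ) ≤ ((m + 2 : ℕ) : ℝ) := by
        exact_mod_cast Nat.sub_le _ _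
      push_cast at this
      gcongr)
    exact ⟨s, hs, h⟩
  choose s hs hsΦ using hex
  refine ⟨fun i => s i ^ 2, ?_, ?_, ?_⟩
  · intro i j hij
    have hlt : s i < s j := by
      by_contra hcon
      have h := hanti (hs j) (hs i) (not_lt.1 hcon)
      rw [hsΦ, hsΦ] at h
      have h' := le_of_mul_le_mul_right h pi_pos
      have h'' : m + 2 - (i : ℕ) ≤ m + 2 - (j : ℕ) := by exact_mod_cast h'
      have hij' : (i : ℕ) < j := hij
      have := j.2
      omega
    have := (hs i).1
    simp only
    nlinarith
  · intro i
    have h := hs i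
    constructor
    · nlinarith [h.1]
    · have := h.2
      have := h.1
      simp only
      nlinarith
  · intro i
    simp only
    rw [eval_extremalPoly hb (hs i).1 (hs i).2]
    have e : 2 * firstPhase b (s i) + (((m + 1 : ℕ) : ℝ) - 1) * secondPhase b (s i) = Φ (s i) := by
      simp only [hΦ]; push_cast; ring
    rw [e, hsΦ, cos_nat_mul_pi]
    ring

/-- Two probability distributions on `{0} ∪ [1, b ^ 2]` with mean one and the same first `m + 2`
moments, with masses at `0` as different as possible. -/
theorem exists_moment_matching {b : ℝ} (hb : 1 < b) (m : ℕ) :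
    ∃ v p q : Fin (m + 4) → ℝ, v 0 = 0 ∧ (∀ i, i ≠ 0 → 1 ≤ v i ∧ v i ≤ b ^ 2) ∧
      (∀ i, 0 ≤ p i) ∧ (∀ i, 0 ≤ q i) ∧ ∑ i, p i = 1 ∧ ∑ i, q i = 1 ∧ ∑ i, p i * v i = 1 ∧
      (∀ j ≤ m + 2, ∑ i, p i * v i ^ j = ∑ i, q i * v i ^ j) ∧
      ((b - 1) / (b + 1)) ^ (m + 2) ≤ q 0 - p 0 := by
  obtain ⟨y, hy, hy1, hQ⟩ := exists_alternation hb m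
  have hb1 : 0 < b - 1 := by linarith
  have hb2 : 0 < b ^ 2 - 1 := by nlinarith
  have hb3 : 0 < b + 1 := by linarith
  set v : Fin (m + 4) → ℝ := Fin.cons 0 y with hv
  have hv0 : v 0 = 0 := rfl
  have hvs : ∀ i : Fin (m + 3), v i.succ = y i := fun i => rfl
  have hmono : StrictMono v := by
    refine Fin.strictMono_iff_lt_succ.2 fun i => ?_
    rw [hvs]
    induction i using Fin.cases with
    | zero => rw [Fin.castSucc_zero, hv0]; linarith [(hy1 0).1]
    | succ i => rw [Fin.castSucc_succ, hvs]; exact hy (Fin.castSucc_lt_succ)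
  set w := Lagrange.nodalWeight Finset.univ v with hw
  have hsign := nodalWeight_sign (n := m + 3) hmono
  have hzero : ∀ P : ℝ[X], P.natDegree < m + 3 →
      w 0 * P.eval 0 + ∑ i : Fin (m + 3), w i.succ * P.eval (y i) = 0 := by
    intro P hP
    have := sum_nodalWeight_mul_eval (n := m + 3) hmono.injective hP
    rwa [Fin.sum_univ_succ] at this
  have hw0 : w 0 ≠ 0 := by
    intro h
    have := hsign 0
    rw [← hw, h, mul_zero] at this
    exact lt_irrefl _ this
  -- This is 2 divided by the modulus of the extremal polynomial at 0. It will be the difference of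
  -- the masses at 0.
  set a := (b ^ 2 - 1) / b ^ 2 * ((b - 1) / (b + 1)) ^ (m + 1) with ha
  have ha0 : 0 < a := by positivity
  have hQ0 : a * |(extremalPoly b (m + 1)).eval 0| = 2 := by
    rw [eval_zero_extremalPoly hb, abs_mul, abs_neg, abs_pow, abs_neg,
      abs_of_pos (by positivity : 0 < 2 * b ^ 2 / (b ^ 2 - 1)),
      abs_of_pos (by positivity : 0 < (b + 1) / (b - 1)), ha, div_pow, div_pow]
    field_simp
  -- The difference q - p away from 0: the divided difference, scaled to have weight `a` at 0.
  set D : Fin (m + 3) → ℝ := fun i => a * w i.succ / w 0 with hD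
  have hmom : ∀ j, j < m + 3 → ∑ i, D i * y i ^ j = -a * 0 ^ j := by
    intro j hj
    have h := hzero (X ^ j) (by rw [natDegree_X_pow]; exact hj)
    simp only [eval_pow, eval_X] at h
    have e : ∑ i, D i * y i ^ j = a / w 0 * ∑ i : Fin (m + 3), w i.succ * y i ^ j := by
      rw [Finset.mul_sum]
      refine Finset.sum_congr rfl fun i _ => ?_
      simp only [hD]; ring
    rw [e, eq_neg_of_add_eq_zero_right h]
    field_simp
  -- The signs of the weights and of the extremal polynomial alternate together, so its divided
  -- difference contains the sum of the |w| y without cancellation.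
  have habs : ∑ i, |D i| * y i = 2 := by
    have h := hzero (extremalPoly b (m + 1))
      (lt_of_le_of_lt (natDegree_extremalPoly_le b (m + 1)) (by omega))
    have e : ∀ i : Fin (m + 3), w i.succ * (extremalPoly b (m + 1)).eval (y i) =
        |w i.succ| * y i := by
      intro i
      rw [hQ]
      have h1 := hsign i.succ
      have h2 : m + 3 - ((i.succ : Fin (m + 4)) : ℕ) = m + 2 - (i : ℕ) := by
        rw [Fin.val_succ]; omega
      rw [h2, ← hw] at h1
      have h3 : |w i.succ| = (-1) ^ (m + 2 - (i : ℕ)) * w i.succ := by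
        rw [← abs_of_pos h1, abs_mul, abs_pow, abs_neg, abs_one, one_pow, one_mul]
      rw [h3]; ring
    rw [Finset.sum_congr rfl fun i _ => e i] at h
    have hpos : 0 ≤ ∑ i : Fin (m + 3), |w i.succ| * y i :=
      Finset.sum_nonneg fun i _ => mul_nonneg (abs_nonneg _) (by linarith [(hy1 i).1])
    have h4 : ∑ i : Fin (m + 3), |w i.succ| * y i =
        |w 0| * |(extremalPoly b (m + 1)).eval 0| := by
      rw [← abs_mul, eq_neg_of_add_eq_zero_left h, abs_neg, abs_of_nonneg hpos]
    have e2 : ∑ i, |D i| * y i = a / |w 0| * ∑ i : Fin (m + 3), |w i.succ| * y i := by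
      rw [Finset.mul_sum]
      refine Finset.sum_congr rfl fun i _ => ?_
      simp only [hD]
      rw [abs_div, abs_mul, abs_of_pos ha0]; ring
    have hw0' : |w 0| ≠ 0 := abs_ne_zero.2 hw0
    rw [e2, h4, ← hQ0]
    field_simp
  have hD0 : ∑ i, D i = -a := by simpa using hmom 0 (by omega)
  have hD1 : ∑ i, D i * y i = 0 := by simpa using hmom 1 (by omega)
  -- Negative and positive parts of `D`. Each has first moment one, by `habs` and `hD1`, hence mass
  -- at most one because y ≥ 1. The missing mass is put at 0.
  set P : Fin (m + 3) → ℝ := fun i => (|D i| - D i) / 2 with hP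
  set Q : Fin (m + 3) → ℝ := fun i => (|D i| + D i) / 2 with hQ'
  have hP0 : ∀ i, 0 ≤ P i := fun i => by simp only [hP]; linarith [le_abs_self (D i)]
  have hQ0 : ∀ i, 0 ≤ Q i := fun i => by simp only [hQ']; linarith [neg_abs_le (D i)]
  have hP1 : ∑ i, P i * y i = 1 := by
    have : ∑ i, P i * y i = (∑ i, |D i| * y i - ∑ i, D i * y i) / 2 := by
      rw [← Finset.sum_sub_distrib, Finset.sum_div]
      exact Finset.sum_congr rfl fun i _ => by simp only [hP]; ring
    rw [this, habs, hD1]; norm_num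
  have hQ1 : ∑ i, Q i * y i = 1 := by
    have : ∑ i, Q i * y i = (∑ i, |D i| * y i + ∑ i, D i * y i) / 2 := by
      rw [← Finset.sum_add_distrib, Finset.sum_div]
      exact Finset.sum_congr rfl fun i _ => by simp only [hQ']; ring
    rw [this, habs, hD1]; norm_num
  have hle : ∀ R : Fin (m + 3) → ℝ, (∀ i, 0 ≤ R i) → ∑ i, R i ≤ ∑ i, R i * y i := fun R hR =>
    Finset.sum_le_sum fun i _ => le_mul_of_one_le_right (hR i) (hy1 i).1
  refine ⟨v, Fin.cons (1 - ∑ i, P i) P, Fin.cons (1 - ∑ i, Q i) Q, hv0, ?_, ?_, ?_, ?_, ?_, ?_,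
    ?_, ?_⟩
  · intro i hi
    obtain ⟨j, rfl⟩ := Fin.exists_succ_eq.2 hi
    exact hy1 j
  · intro i
    induction i using Fin.cases with
    | zero => rw [Fin.cons_zero, sub_nonneg, ← hP1]; exact hle P hP0
    | succ i => rw [Fin.cons_succ]; exact hP0 i
  · intro i
    induction i using Fin.cases with
    | zero => rw [Fin.cons_zero, sub_nonneg, ← hQ1]; exact hle Q hQ0
    | succ i => rw [Fin.cons_succ]; exact hQ0 i
  · rw [Fin.sum_univ_succ]; simp
  · rw [Fin.sum_univ_succ]; simp
  · rw [Fin.sum_univ_succ, hv0, mul_zero, zero_add, ← hP1]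
    simp [hvs]
  · intro j hj
    have hsum : ∀ f : Fin (m + 4) → ℝ, ∑ i, f i = f 0 + ∑ i : Fin (m + 3), f i.succ :=
      fun f => Fin.sum_univ_succ f
    rcases Nat.eq_zero_or_pos j with rfl | hj0
    · rw [hsum, hsum]; simp
    · rw [hsum, hsum, hv0, zero_pow hj0.ne', mul_zero, mul_zero,
        zero_add, zero_add]
      simp only [Fin.cons_succ, hvs]
      have h := hmom j (by omega)
      rw [zero_pow hj0.ne', mul_zero] at h
      rw [← sub_eq_zero, ← Finset.sum_sub_distrib, ← neg_eq_zero, ← h, ← Finset.sum_neg_distrib]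
      exact Finset.sum_congr rfl fun i _ => by simp only [hP, hQ']; ring
  · rw [Fin.cons_zero, Fin.cons_zero]
    have : 1 - ∑ i, Q i - (1 - ∑ i, P i) = - ∑ i, D i := by
      rw [sub_sub_sub_cancel_left, ← Finset.sum_sub_distrib, ← Finset.sum_neg_distrib]
      exact Finset.sum_congr rfl fun i _ => by simp only [hP, hQ']; ring
    rw [this, hD0, neg_neg, ha, pow_succ, mul_comm]
    refine mul_le_mul_of_nonneg_right ?_ (by positivity)
    rw [div_le_div_iff₀ hb3 (by positivity)]
    nlinarith [mul_pos hb1 hb3]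

end Matching

/-! ### Interpolation error at Chebyshev nodes -/

section Interpolation
open Polynomial
open scoped ContDiff Nat

/-- Generalized Rolle theorem. -/
theorem exists_iteratedDeriv_eq_zero {a b : ℝ} (n : ℕ) :
    ∀ {g : ℝ → ℝ}, ContDiff ℝ ∞ g → ∀ {z : Fin (n + 1) → ℝ}, StrictMono z →
      (∀ i, z i ∈ Set.Icc a b) → (∀ i, g (z i) = 0) →
      ∃ ξ ∈ Set.Icc a b, iteratedDeriv n g ξ = 0 := by
  induction n with
  | zero =>
    intro g _ z _ hab h0
    exact ⟨z 0, hab 0, by simpa using h0 0⟩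
  | succ n ih =>
    intro g hg z hz hab h0
    have hex : ∀ i : Fin (n + 1), ∃ c ∈ Set.Ioo (z i.castSucc) (z i.succ), deriv g c = 0 :=
      fun i => exists_deriv_eq_zero (hz Fin.castSucc_lt_succ) hg.continuous.continuousOn
        (by rw [h0, h0])
    choose c hc hc0 using hex
    have hmono : StrictMono c := by
      cases n with
      | zero => exact Subsingleton.strictMono (α := Fin 1) c
      | succ n =>
        refine Fin.strictMono_iff_lt_succ.2 fun i => ?_
        have h1 := (hc i.castSucc).2
        have h2 := (hc i.succ).1
        rw [Fin.succ_castSucc] at h1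
        exact h1.trans h2
    rw [iteratedDeriv_succ']
    refine ih (contDiff_infty_iff_deriv.1 hg).2 hmono (fun i => ?_) hc0
    exact ⟨(hab _).1.trans (hc i).1.le, (hc i).2.le.trans (hab _).2⟩

theorem iteratedDeriv_polynomial_eval (P : ℝ[X]) (n : ℕ) :
    iteratedDeriv n (fun x => P.eval x) = fun x => (derivative^[n] P).eval x := by
  induction n generalizing P with
  | zero => simp
  | succ n ih =>
    rw [iteratedDeriv_succ', Function.iterate_succ_apply, ← ih]
    congr 1
    funext x
    exact P.deriv

theorem iterate_derivative_of_natDegree_le {P : ℝ[X]} {n : ℕ} (h : P.natDegree ≤ n) :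
    derivative^[n] P = C (n ! * P.coeff n) := by
  have h0 : (derivative^[n] P).natDegree ≤ 0 := by
    have := natDegree_iterate_derivative P n
    omega
  rw [eq_C_of_natDegree_le_zero h0, coeff_iterate_derivative, zero_add, Nat.descFactorial_self,
    nsmul_eq_mul]

/-- The error of interpolation at the Chebyshev nodes of `[0, M]`. -/
theorem exists_polynomial_approx {f : ℝ → ℝ} (hf : ContDiff ℝ ∞ f) {M K : ℝ} (hM : 0 < M) (n : ℕ)
    (hK : ∀ x ∈ Set.Icc 0 M, |iteratedDeriv (n + 1) f x| ≤ K) :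
    ∃ P : ℝ[X], P.natDegree ≤ n ∧
      ∀ x ∈ Set.Icc 0 M, |f x - P.eval x| ≤ 2 * (M / 4) ^ (n + 1) / (n + 1)! * K := by
  set T := Chebyshev.T ℝ ((n + 1 : ℕ) : ℤ) with hT
  set lin : ℝ[X] := C (2 / M) * X + C (-1) with hlin
  set Q := T.comp lin with hQ
  have hlinev : ∀ x, lin.eval x = 2 / M * x - 1 := fun x => by simp [hlin, sub_eq_add_neg]
  have h2M : 2 / M ≠ 0 := by positivity
  have hlind : lin.natDegree = 1 := natDegree_linear h2M
  have hlinl : lin.leadingCoeff = 2 / M := leadingCoeff_linear h2M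
  have hTd : T.natDegree = n + 1 := by rw [hT, Chebyshev.natDegree_T, Int.natAbs_natCast]
  have hQd : Q.natDegree = n + 1 := by rw [hQ, natDegree_comp, hTd, hlind, mul_one]
  have hQc : Q.coeff (n + 1) = 2 ^ n * (2 / M) ^ (n + 1) := by
    rw [← congrArg Q.coeff hQd, coeff_natDegree, hQ, leadingCoeff_comp (by rw [hlind]; norm_num), hlinl, hTd, hT,
      Chebyshev.leadingCoeff_T, Int.natAbs_natCast, Nat.add_sub_cancel]
  set s : Finset ℝ := T.roots.toFinset.image fun t => M / 2 * (1 + t) with hs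
  have hT0 : T ≠ 0 := by
    intro h
    rw [h] at hTd
    simp at hTd
  have hinj : Function.Injective fun t : ℝ => M / 2 * (1 + t) := by
    intro t u h
    have : M / 2 ≠ 0 := by positivity
    have := mul_left_cancel₀ this h
    linarith
  have hmem : ∀ x, x ∈ s ↔ Q.eval x = 0 := by
    intro x
    rw [hs, Finset.mem_image, hQ, eval_comp, hlinev]
    constructor
    · rintro ⟨t, ht, rfl⟩
      rw [Multiset.mem_toFinset, mem_roots hT0, IsRoot] at ht
      have : 2 / M * (M / 2 * (1 + t)) - 1 = t := by field_simp; ring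
      rw [this, ht]
    · intro h
      refine ⟨2 / M * x - 1, ?_, by field_simp; ring⟩
      rw [Multiset.mem_toFinset, mem_roots hT0]
      exact h
  have hcard : s.card = n + 1 := by
    rw [hs, Finset.card_image_of_injective _ hinj, hT, Chebyshev.roots_T_real, Finset.val_toFinset,
      Finset.card_image_of_injOn, Finset.card_range]
    exact (Finset.range (n + 1)).nodup_map_iff_injOn.mp (Chebyshev.roots_T_real_nodup (n + 1))
  have hsM : ∀ x ∈ s, x ∈ Set.Icc 0 M := by
    intro x hx
    rw [hs, Finset.mem_image] at hx
    obtain ⟨t, ht, rfl⟩ := hx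
    rw [hT, Chebyshev.roots_T_real, Finset.val_toFinset, Finset.mem_image] at ht
    obtain ⟨k, -, rfl⟩ := ht
    have h1 := neg_one_le_cos ((2 * (k : ℝ) + 1) * π / (2 * ((n + 1 : ℕ) : ℝ)))
    have h2 := cos_le_one ((2 * (k : ℝ) + 1) * π / (2 * ((n + 1 : ℕ) : ℝ)))
    constructor <;> nlinarith
  set P := Lagrange.interpolate s id f with hP
  have hPdeg : P.degree < (n + 1 : ℕ) := by
    rw [← hcard]
    exact Lagrange.degree_interpolate_lt f (Set.injOn_id _)
  have hPd : P.natDegree ≤ n := 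
    natDegree_le_iff_coeff_eq_zero.2 fun N hN =>
      coeff_eq_zero_of_degree_lt (hPdeg.trans_le (by exact_mod_cast hN))
  refine ⟨P, hPd, fun x hx => ?_⟩
  have hK0 : 0 ≤ K := (abs_nonneg _).trans (hK x hx)
  by_cases hxs : x ∈ s
  · have : P.eval x = f x := Lagrange.eval_interpolate_at_node f (Set.injOn_id _) hxs
    rw [this, sub_self, abs_zero]
    positivity
  have hQx : Q.eval x ≠ 0 := fun h => hxs ((hmem x).2 h)
  -- With this `c`, P + cQ agrees with f at x as well as at the nodes, so Rolle gives (n+1)! c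
  -- lead(Q) = f⁽ⁿ⁺¹⁾(ξ). Here lead(Q) = 2ⁿ(2/M)ⁿ⁺¹ is the reciprocal of 2(M/4)ⁿ⁺¹.
  set c := (f x - P.eval x) / Q.eval x with hc
  have hQle : |Q.eval x| ≤ 1 := by
    rw [hQ, eval_comp, hlinev]
    refine Chebyshev.abs_eval_T_real_le_one _ (abs_le.2 ?_)
    have h2 : 2 / M * x ≤ 2 := by
      rw [div_mul_eq_mul_div, div_le_iff₀ hM]; linarith [hx.2]
    have h1 : 0 ≤ 2 / M * x := mul_nonneg (by positivity) hx.1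
    constructor <;> linarith
  set R := P + C c * Q with hR
  have hRd : R.natDegree ≤ n + 1 := by
    refine natDegree_add_le_of_degree_le (by omega) ?_
    exact (natDegree_C_mul_le _ _).trans hQd.le
  have hRc : R.coeff (n + 1) = c * (2 ^ n * (2 / M) ^ (n + 1)) := by
    rw [hR, coeff_add, coeff_C_mul, hQc, coeff_eq_zero_of_natDegree_lt (by omega), zero_add]
  have hcard' : (insert x s).card = n + 1 + 1 := by
    rw [Finset.card_insert_of_notMem hxs, hcard]
  have hRC : ContDiff ℝ ∞ fun t => R.eval t := by
    simpa using R.contDiff_aeval (𝕜 := ℝ) (R := ℝ) ∞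
  obtain ⟨ξ, hξ, h0⟩ := exists_iteratedDeriv_eq_zero (a := 0) (b := M) (n + 1)
    (g := f - fun t => R.eval t) (hf.sub hRC)
    (z := (insert x s).orderEmbOfFin hcard') (OrderEmbedding.strictMono _)
    (fun i => by
      rcases Finset.mem_insert.1 (Finset.orderEmbOfFin_mem (insert x s) hcard' i) with h | h
      · rw [h]; exact hx
      · exact hsM _ h)
    (fun i => by
      rw [Pi.sub_apply, hR, eval_add, eval_mul, eval_C]
      rcases Finset.mem_insert.1 (Finset.orderEmbOfFin_mem (insert x s) hcard' i) with h | h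
      · rw [h, hc]; field_simp; ring
      · have h1 : P.eval _ = f _ := Lagrange.eval_interpolate_at_node f (Set.injOn_id _) h
        rw [(hmem _).1 h]
        simp only [id] at h1
        rw [h1]; ring)
  rw [iteratedDeriv_sub (hf.of_le (by exact_mod_cast le_top)).contDiffAt
    (hRC.of_le (by exact_mod_cast le_top)).contDiffAt, iteratedDeriv_polynomial_eval,
    iterate_derivative_of_natDegree_le hRd] at h0
  simp only [eval_C, hRc] at h0
  have hcK : |c| * ((n + 1)! * (2 ^ n * (2 / M) ^ (n + 1))) ≤ K := by
    refine le_trans (le_of_eq ?_) (hK ξ hξ)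
    rw [sub_eq_zero.1 h0, abs_mul, abs_mul, Nat.abs_cast,
      abs_of_pos (by positivity : 0 < 2 ^ n * (2 / M) ^ (n + 1))]
    ring
  have hfx : f x - P.eval x = c * Q.eval x := by rw [hc]; field_simp
  rw [hfx, abs_mul]
  calc |c| * |Q.eval x| ≤ |c| := mul_le_of_le_one_right (abs_nonneg _) hQle
    _ = 2 * (M / 4) ^ (n + 1) / (n + 1)! * (|c| * ((n + 1)! * (2 ^ n * (2 / M) ^ (n + 1)))) := by
      have h4 : (4 : ℝ) ^ (n + 1) = 2 ^ n * 2 * 2 ^ (n + 1) := by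
        rw [← pow_succ, ← mul_pow]; norm_num
      rw [div_pow, div_pow, h4]
      field_simp
    _ ≤ _ := mul_le_mul_of_nonneg_left hcK (by positivity)

end Interpolation

/-! ### Poisson mixtures with matching moments -/

section Poisson
open scoped ContDiff Nat

noncomputable def poissonTerm (j : ℕ) (x : ℝ) : ℝ := exp (-x) * x ^ j / j !

theorem contDiff_poissonTerm (j : ℕ) : ContDiff ℝ ∞ (poissonTerm j) := by
  unfold poissonTerm
  fun_prop

theorem deriv_poissonTerm_zero : deriv (poissonTerm 0) = -poissonTerm 0 := by
  funext x
  have h : HasDerivAt (poissonTerm 0) (-poissonTerm 0 x) x := by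
    have h1 := (hasDerivAt_neg x).exp
    have h2 : poissonTerm 0 = fun y => exp (-y) := by funext y; simp [poissonTerm]
    rw [h2]
    exact h1.congr_deriv (by ring)
  exact h.deriv

theorem deriv_poissonTerm_succ (j : ℕ) :
    deriv (poissonTerm (j + 1)) = poissonTerm j - poissonTerm (j + 1) := by
  funext x
  have h : HasDerivAt (poissonTerm (j + 1)) ((poissonTerm j - poissonTerm (j + 1)) x) x := by
    have h1 := ((hasDerivAt_neg x).exp.mul (hasDerivAt_pow (j + 1) x)).div_const ((j + 1)! : ℝ)
    have h2 : HasDerivAt (poissonTerm (j + 1)) _ x := h1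
    refine h2.congr_deriv ?_
    simp only [Pi.sub_apply, poissonTerm, Nat.factorial_succ, Nat.cast_mul, Nat.add_sub_cancel]
    have : ((j + 1 : ℕ) : ℝ) ≠ 0 := by positivity
    field_simp
    ring
  exact h.deriv

theorem poissonTerm_nonneg (j : ℕ) {x : ℝ} (hx : 0 ≤ x) : 0 ≤ poissonTerm j x := by
  unfold poissonTerm; positivity

theorem hasSum_poissonTerm (x : ℝ) : HasSum (fun j => poissonTerm j x) 1 := by
  have h := (NormedSpace.expSeries_div_hasSum_exp x).mul_left (exp (-x))
  rw [← Real.exp_eq_exp_ℝ, ← exp_add, neg_add_cancel, exp_zero] at h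
  refine h.congr_fun fun j => ?_
  rw [poissonTerm, mul_div_assoc]

theorem poissonTerm_le_one (j : ℕ) {x : ℝ} (hx : 0 ≤ x) : poissonTerm j x ≤ 1 := by
  have h := pow_div_factorial_le_exp x hx j
  rw [poissonTerm, mul_div_assoc, exp_neg, inv_mul_le_iff₀ (exp_pos x), mul_one]
  exact h

/-- The function e^(-x) x^j increases up to its maximum at x = j. -/
theorem poissonTerm_mono {j : ℕ} {x M : ℝ} (hx : 0 ≤ x) (hxM : x ≤ M) (hM : M ≤ j) :
    poissonTerm j x ≤ poissonTerm j M := by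
  rcases hx.eq_or_lt with rfl | hx0
  · rcases Nat.eq_zero_or_pos j with rfl | hj
    · have : M = 0 := le_antisymm (by simpa using hM) hxM
      rw [this]
    · rw [poissonTerm, zero_pow hj.ne', mul_zero, zero_div]
      exact poissonTerm_nonneg j hxM
  have hM0 : 0 < M := by linarith
  unfold poissonTerm
  refine div_le_div_of_nonneg_right ?_ (by positivity)
  rw [← exp_log (pow_pos hx0 j), ← exp_log (pow_pos hM0 j), ← exp_add, ← exp_add, exp_le_exp,
    log_pow, log_pow]
  have h1 : log (x / M) ≤ x / M - 1 := log_le_sub_one_of_pos (by positivity)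
  rw [log_div hx0.ne' hM0.ne'] at h1
  have h2 : x / M - 1 ≤ 0 := by rw [sub_nonpos, div_le_one hM0]; exact hxM
  have h3 : (j : ℝ) * (log x - log M) ≤ j * (x / M - 1) :=
    mul_le_mul_of_nonneg_left h1 (Nat.cast_nonneg j)
  have h4 : (j : ℝ) * (x / M - 1) ≤ M * (x / M - 1) := mul_le_mul_of_nonpos_right hM h2
  have h5 : M * (x / M - 1) = x - M := by field_simp
  linarith

/-- The bound on [0, M] is taken before summing over j. For n = 0, terms with j < ⌈M⌉ are at most 1
and the others are largest at M, so the total is at most ⌈M⌉ + 1. The derivative of term j is term j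
- 1 minus term j, so each differentiation at most doubles the total. -/
theorem exists_bound_iteratedDeriv_poissonTerm {M : ℝ} (hM : 0 < M) (n : ℕ) :
    ∃ s : ℕ → ℝ, (∀ j, 0 ≤ s j) ∧ Summable s ∧ ∑' j, s j ≤ 2 ^ n * (M + 2) ∧
      ∀ j, ∀ x ∈ Set.Icc 0 M, |iteratedDeriv n (poissonTerm j) x| ≤ s j := by
  induction n with
  | zero =>
    set N := ⌈M⌉₊ with hN
    have h1 : HasSum (fun j : ℕ => if j ∈ Finset.range N then (1 : ℝ) else 0) N := by
      have := hasSum_sum_of_ne_finset_zero (L := SummationFilter.unconditional ℕ)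
        (f := fun j => if j ∈ Finset.range N then (1 : ℝ) else 0)
        (s := Finset.range N) (fun j hj => if_neg hj)
      convert! this using 1
      rw [Finset.sum_congr rfl fun j hj => if_pos hj]
      simp
    have h2 := h1.add (hasSum_poissonTerm M)
    refine ⟨_, fun j => ?_, h2.summable, ?_, fun j x hx => ?_⟩
    · have := poissonTerm_nonneg j hM.le
      split_ifs <;> linarith
    · rw [h2.tsum_eq]
      have := Nat.ceil_lt_add_one hM.le
      linarith
    · rw [iteratedDeriv_zero, abs_of_nonneg (poissonTerm_nonneg j hx.1)]
      split_ifs with hj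
      · have := poissonTerm_le_one j hx.1
        have := poissonTerm_nonneg j hM.le
        linarith
      · rw [zero_add]
        refine poissonTerm_mono hx.1 hx.2 ((Nat.le_ceil M).trans ?_)
        rw [Finset.mem_range, not_lt] at hj
        exact_mod_cast hj
  | succ n ih =>
    obtain ⟨s, hs0, hs, hsum, hb⟩ := ih
    have h1 : Summable fun j => match j with
        | 0 => s 0
        | j + 1 => s j + s (j + 1) := by
      refine (summable_nat_add_iff 1).1 ?_
      exact hs.add ((summable_nat_add_iff 1).2 hs)
    refine ⟨_, fun j => ?_, h1, ?_, fun j x hx => ?_⟩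
    · cases j with
      | zero => exact hs0 0
      | succ j => exact add_nonneg (hs0 _) (hs0 _)
    · rw [h1.tsum_eq_zero_add]
      simp only
      rw [hs.tsum_add ((summable_nat_add_iff 1).2 hs), add_left_comm, ← hs.tsum_eq_zero_add, pow_succ]
      linarith
    · cases j with
      | zero =>
        rw [iteratedDeriv_succ', deriv_poissonTerm_zero, iteratedDeriv_neg, abs_neg]
        exact hb 0 x hx
      | succ j =>
        rw [iteratedDeriv_succ', deriv_poissonTerm_succ, iteratedDeriv_sub
          ((contDiff_poissonTerm j).of_le (by exact_mod_cast le_top)).contDiffAt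
          ((contDiff_poissonTerm (j + 1)).of_le (by exact_mod_cast le_top)).contDiffAt]
        exact (abs_sub _ _).trans (add_le_add (hb j x hx) (hb (j + 1) x hx))

/-- Poisson mixtures with matching moments are close in total variation. -/
theorem tsum_abs_poisson_mixture_le {ι : Type*} [Fintype ι] {V p q : ι → ℝ} {M : ℝ} {n : ℕ}
    (hM : 0 < M) (hV : ∀ i, V i ∈ Set.Icc 0 M) (hp : ∀ i, 0 ≤ p i) (hq : ∀ i, 0 ≤ q i)
    (hp1 : ∑ i, p i = 1) (hq1 : ∑ i, q i = 1)
    (hmom : ∀ j ≤ n, ∑ i, p i * V i ^ j = ∑ i, q i * V i ^ j) :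
    ∑' j, ENNReal.ofReal |∑ i, p i * poissonTerm j (V i) - ∑ i, q i * poissonTerm j (V i)| ≤
      ENNReal.ofReal (4 * (M + 2) * (M / 2) ^ (n + 1) / (n + 1)!) := by
  obtain ⟨s, hs0, hs, hsum, hb⟩ := exists_bound_iteratedDeriv_poissonTerm hM (n + 1)
  -- Twice the interpolation error, once for each law; the interpolant has the same mean under both.
  set c := 2 * (2 * (M / 4) ^ (n + 1) / (n + 1)!) with hc
  have hc0 : 0 ≤ c := by positivity
  have hj : ∀ j, |∑ i, p i * poissonTerm j (V i) - ∑ i, q i * poissonTerm j (V i)| ≤ c * s j := by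
    intro j
    obtain ⟨P, hP, hPx⟩ := exists_polynomial_approx (contDiff_poissonTerm j) hM n (hb j)
    have hPe : ∑ i, p i * P.eval (V i) = ∑ i, q i * P.eval (V i) := by
      have h : ∀ r : ι → ℝ, ∑ i, r i * P.eval (V i) =
          ∑ k ∈ Finset.range (n + 1), P.coeff k * ∑ i, r i * V i ^ k := by
        intro r
        simp_rw [Polynomial.eval_eq_sum_range' (Nat.lt_succ_of_le hP), Finset.mul_sum]
        rw [Finset.sum_comm]
        refine Finset.sum_congr rfl fun k _ => Finset.sum_congr rfl fun i _ => ?_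
        ring
      rw [h, h]
      refine Finset.sum_congr rfl fun k hk => ?_
      rw [hmom k (Nat.lt_succ_iff.1 (Finset.mem_range.1 hk))]
    have hbd : ∀ r : ι → ℝ, (∀ i, 0 ≤ r i) → ∑ i, r i = 1 →
        |∑ i, r i * poissonTerm j (V i) - ∑ i, r i * P.eval (V i)| ≤
          2 * (M / 4) ^ (n + 1) / (n + 1)! * s j := by
      intro r hr hr1
      rw [← Finset.sum_sub_distrib]
      refine (Finset.abs_sum_le_sum_abs _ _).trans ?_
      calc ∑ i, |r i * poissonTerm j (V i) - r i * P.eval (V i)|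
          ≤ ∑ i, r i * (2 * (M / 4) ^ (n + 1) / (n + 1)! * s j) := by
            refine Finset.sum_le_sum fun i _ => ?_
            rw [← mul_sub, abs_mul, abs_of_nonneg (hr i)]
            exact mul_le_mul_of_nonneg_left (hPx _ (hV i)) (hr i)
        _ = _ := by rw [← Finset.sum_mul, hr1, one_mul]
    have h1 := abs_le.1 (hbd p hp hp1)
    have h2 := abs_le.1 (hbd q hq hq1)
    rw [hPe] at h1
    rw [hc, abs_le]
    constructor <;> linarith [h1.1, h1.2, h2.1, h2.2]
  calc ∑' j, ENNReal.ofReal |∑ i, p i * poissonTerm j (V i) - ∑ i, q i * poissonTerm j (V i)|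
      ≤ ∑' j, ENNReal.ofReal (c * s j) := ENNReal.tsum_le_tsum fun j =>
        ENNReal.ofReal_le_ofReal (hj j)
    _ = ENNReal.ofReal (∑' j, c * s j) :=
        (ENNReal.ofReal_tsum_of_nonneg (fun j => mul_nonneg hc0 (hs0 j)) (hs.mul_left c)).symm
    _ ≤ _ := by
        refine ENNReal.ofReal_le_ofReal ?_
        rw [tsum_mul_left]
        refine (mul_le_mul_of_nonneg_left hsum hc0).trans (le_of_eq ?_)
        -- The factor 2ⁿ⁺¹ from differentiation turns (M/4)ⁿ⁺¹ into (M/2)ⁿ⁺¹.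
        have h4 : (4 : ℝ) ^ (n + 1) = 2 ^ (n + 1) * 2 ^ (n + 1) := by
          rw [← mul_pow]; norm_num
        rw [hc, div_pow, div_pow, h4]
        field_simp
        ring

end Poisson

/-! ### Counts of symbols and product laws -/

section Counting
open scoped Nat ENNReal

/-- The number of occurrences of each symbol in a finite sequence. -/
def countVec {N m : ℕ} (x : Fin N → Fin m) : Fin m → ℕ :=
  fun i => (Finset.univ.filter fun j => x j = i).card

theorem sum_countVec {N m : ℕ} (x : Fin N → Fin m) : ∑ i, countVec x i = N := by
  have := Finset.card_eq_sum_card_fiberwise (f := x) (s := Finset.univ) (t := Finset.univ)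
    (fun _ _ => Finset.mem_coe.2 (Finset.mem_univ _))
  rw [Finset.card_univ, Fintype.card_fin] at this
  exact this.symm

theorem prod_comp_eq_prod_pow_countVec {R : Type*} [CommMonoid R] {N m : ℕ} (x : Fin N → Fin m)
    (f : Fin m → R) : ∏ j, f (x j) = ∏ i, f i ^ countVec x i := by
  rw [Finset.prod_comp]
  exact Finset.prod_subset (Finset.subset_univ _) fun i _ hi => by
    have : (Finset.univ.filter fun j => x j = i) = ∅ := by
      rw [Finset.filter_eq_empty_iff]
      intro j _ h
      exact hi (Finset.mem_image.2 ⟨j, Finset.mem_univ _, h⟩)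
    rw [this, Finset.card_empty, pow_zero]

/-- Both numbers are the coefficient of ∏ Xᵢ^aᵢ in (∑ Xᵢ)ᴺ, expanded over sequences and by the
multinomial theorem. -/
theorem card_countVec_eq {N m : ℕ} {a : Fin m → ℕ} (ha : ∑ i, a i = N) :
    (Finset.univ.filter fun x : Fin N → Fin m => countVec x = a).card =
      Nat.multinomial Finset.univ a := by
  have hmon : ∀ c : Fin m → ℕ, (∏ i, (MvPolynomial.X i : MvPolynomial (Fin m) ℕ) ^ c i) =
      MvPolynomial.monomial (Finsupp.equivFunOnFinite.symm c) 1 := by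
    intro c
    rw [MvPolynomial.monomial_eq, map_one, one_mul, Finsupp.prod_fintype _ _ (by simp)]
    rfl
  have h1 : (∑ i, (MvPolynomial.X i : MvPolynomial (Fin m) ℕ)) ^ N =
      ∑ x : Fin N → Fin m, MvPolynomial.monomial (Finsupp.equivFunOnFinite.symm (countVec x)) 1 := by
    rw [← Fin.prod_const N, Finset.prod_univ_sum, Fintype.piFinset_univ]
    refine Finset.sum_congr rfl fun x _ => ?_
    rw [← hmon, prod_comp_eq_prod_pow_countVec x (fun i => (MvPolynomial.X i :
      MvPolynomial (Fin m) ℕ))]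
  have h2 := congrArg (MvPolynomial.coeff (Finsupp.equivFunOnFinite.symm a))
    (h1.symm.trans (Finset.sum_pow_eq_sum_piAntidiag Finset.univ
      (fun i => (MvPolynomial.X i : MvPolynomial (Fin m) ℕ)) N))
  rw [MvPolynomial.coeff_sum, MvPolynomial.coeff_sum] at h2
  simp only [hmon, MvPolynomial.coeff_monomial, EmbeddingLike.apply_eq_iff_eq] at h2
  rw [Finset.card_filter, h2, Finset.sum_eq_single a]
  · rw [← MvPolynomial.C_eq_coe_nat, MvPolynomial.coeff_C_mul, MvPolynomial.coeff_monomial,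
      if_pos rfl, mul_one]
    rfl
  · intro c _ hc
    rw [← MvPolynomial.C_eq_coe_nat, MvPolynomial.coeff_C_mul, MvPolynomial.coeff_monomial,
      if_neg (by rwa [EmbeddingLike.apply_eq_iff_eq]), mul_zero]
  · intro h
    exact absurd (Finset.mem_piAntidiag.2 ⟨ha, fun _ _ => Finset.mem_univ _⟩) h

/-- The exponential formula: summing over sequences of all lengths amounts to summing over
vectors of independent counts. -/
theorem tsum_sum_countVec {m : ℕ} (F : (Fin m → ℕ) → ℝ≥0∞) :
    ∑' N : ℕ, (N ! : ℝ≥0∞)⁻¹ * ∑ x : Fin N → Fin m, F (countVec x) =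
      ∑' a : Fin m → ℕ, F a * ∏ i, ((a i)! : ℝ≥0∞)⁻¹ := by
  have h1 : ∀ N : ℕ, (N ! : ℝ≥0∞)⁻¹ * ∑ x : Fin N → Fin m, F (countVec x) =
      ∑' a : Fin m → ℕ, if ∑ i, a i = N then F a * ∏ i, ((a i)! : ℝ≥0∞)⁻¹ else 0 := by
    intro N
    rw [tsum_eq_sum (s := Finset.piAntidiag Finset.univ N) (fun a ha => if_neg fun h =>
      ha (Finset.mem_piAntidiag.2 ⟨h, fun _ _ => Finset.mem_univ _⟩)),
      ← Finset.sum_fiberwise_of_maps_to (s := Finset.univ)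
        (t := Finset.piAntidiag Finset.univ N) (g := countVec)
        (fun x _ => Finset.mem_piAntidiag.2 ⟨sum_countVec x, fun _ _ => Finset.mem_univ _⟩),
      Finset.mul_sum]
    refine Finset.sum_congr rfl fun a ha => ?_
    have ha' := (Finset.mem_piAntidiag.1 ha).1
    rw [if_pos ha', Finset.sum_congr rfl (g := fun _ => F a) (fun x hx => by
      rw [(Finset.mem_filter.1 hx).2]), Finset.sum_const, card_countVec_eq ha', nsmul_eq_mul]
    have hs := Nat.multinomial_spec Finset.univ a
    have hN : ∀ n : ℕ, (n ! : ℝ≥0∞) ≠ 0 := fun n => by exact_mod_cast n.factorial_ne_zero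
    have hN' : ∀ n : ℕ, (n ! : ℝ≥0∞) ≠ ∞ := fun n => ENNReal.natCast_ne_top _
    have hP : ∏ i, ((a i)! : ℝ≥0∞)⁻¹ = (∏ i, ((a i)! : ℝ≥0∞))⁻¹ :=
      (ENNReal.prod_inv_distrib (fun i _ j _ _ => Or.inl (hN _))).symm
    have hs' : (∏ i, ((a i)! : ℝ≥0∞)) * (Nat.multinomial Finset.univ a : ℝ≥0∞) = (N ! : ℝ≥0∞) := by
      rw [← ha', ← hs]; push_cast; rfl
    rw [hP, ← mul_assoc, mul_comm (F a)]
    congr 1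
    refine ENNReal.eq_inv_of_mul_eq_one_left ?_
    rw [mul_assoc, mul_comm (Nat.multinomial Finset.univ a : ℝ≥0∞), hs',
      ENNReal.inv_mul_cancel (hN N) (hN' N)]
  rw [tsum_congr h1, ENNReal.tsum_comm]
  refine tsum_congr fun a => ?_
  rw [tsum_eq_single (∑ i, a i) (fun N hN => if_neg (Ne.symm hN)), if_pos rfl]

theorem tsum_fin_succ {α : Type*} {m : ℕ} (F : (Fin (m + 1) → α) → ℝ≥0∞) :
    ∑' a, F a = ∑' c, ∑' a : Fin m → α, F (Fin.cons c a) := by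
  rw [← (Fin.consEquiv fun _ => α).tsum_eq,
    ← ENNReal.tsum_prod (f := fun c (a : Fin m → α) => F (Fin.cons c a))]
  rfl

theorem tsum_prod_family_eq_one {m : ℕ} {f : Fin m → ℕ → ℝ≥0∞} (hf : ∀ i, ∑' j, f i j = 1) :
    ∑' a : Fin m → ℕ, ∏ i, f i (a i) = 1 := by
  induction m with
  | zero => rw [tsum_eq_single default (fun a ha => absurd (Subsingleton.elim _ _) ha)]; simp
  | succ m ih =>
    rw [tsum_fin_succ]
    simp_rw [Fin.prod_univ_succ, Fin.cons_zero, Fin.cons_succ, ENNReal.tsum_mul_left,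
      ih fun i => hf i.succ, mul_one]
    exact hf 0

/-- The total variation distance of product laws is at most additive. -/
theorem tsum_abs_prod_sub_prod_le {f g : ℕ → ℝ} (hf0 : ∀ j, 0 ≤ f j) (hg0 : ∀ j, 0 ≤ g j)
    (hf : ∑' j, ENNReal.ofReal (f j) = 1) (hg : ∑' j, ENNReal.ofReal (g j) = 1) (m : ℕ) :
    ∑' a : Fin m → ℕ, ENNReal.ofReal |∏ i, f (a i) - ∏ i, g (a i)| ≤
      m * ∑' j, ENNReal.ofReal |f j - g j| := by
  induction m with
  | zero => simp
  | succ m ih =>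
    set β := ∑' j, ENNReal.ofReal |f j - g j| with hβ
    have hF : ∑' a : Fin m → ℕ, ENNReal.ofReal (∏ i, f (a i)) = 1 := by
      simp_rw [ENNReal.ofReal_prod_of_nonneg fun i _ => hf0 _]
      exact tsum_prod_family_eq_one fun _ => hf
    rw [tsum_fin_succ]
    calc _ ≤ ∑' c, ∑' a : Fin m → ℕ, (ENNReal.ofReal |f c - g c| * ENNReal.ofReal (∏ i, f (a i)) +
          ENNReal.ofReal (g c) * ENNReal.ofReal |∏ i, f (a i) - ∏ i, g (a i)|) := by
          refine ENNReal.tsum_le_tsum fun c => ENNReal.tsum_le_tsum fun a => ?_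
          rw [Fin.prod_univ_succ, Fin.prod_univ_succ]
          simp only [Fin.cons_zero, Fin.cons_succ]
          rw [← ENNReal.ofReal_mul (abs_nonneg _), ← ENNReal.ofReal_mul (hg0 c),
            ← ENNReal.ofReal_add (mul_nonneg (abs_nonneg _) (Finset.prod_nonneg fun i _ => hf0 _))
              (mul_nonneg (hg0 c) (abs_nonneg _))]
          refine ENNReal.ofReal_le_ofReal ?_
          have e : f c * ∏ i, f (a i) - g c * ∏ i, g (a i) =
            (f c - g c) * ∏ i, f (a i) + g c * (∏ i, f (a i) - ∏ i, g (a i)) := by ring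
          rw [e]
          refine (abs_add_le _ _).trans (le_of_eq ?_)
          rw [abs_mul, abs_mul, abs_of_nonneg (hg0 c),
            abs_of_nonneg (Finset.prod_nonneg fun i _ => hf0 _)]
      _ = β * 1 + 1 * ∑' a : Fin m → ℕ, ENNReal.ofReal |∏ i, f (a i) - ∏ i, g (a i)| := by
          simp_rw [ENNReal.tsum_add, ENNReal.tsum_mul_left, ENNReal.tsum_mul_right, hF, hg, ← hβ]
      _ ≤ β + m * β := by rw [mul_one, one_mul]; gcongr
      _ = _ := by push_cast; ring

end Counting

/-! ### Moments of sums under product weights -/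

section ProductWeights

theorem sum_fin_succ_fun {κ : Type*} [Fintype κ] {m : ℕ} (F : (Fin (m + 1) → κ) → ℝ) :
    ∑ u, F u = ∑ c, ∑ u : Fin m → κ, F (Fin.cons c u) := by
  rw [← (Fin.consEquiv fun _ => κ).sum_comp, Fintype.sum_prod_type]
  rfl

theorem sum_prod_weights {κ : Type*} [Fintype κ] {p : κ → ℝ} (hp : ∑ c, p c = 1) (m : ℕ) :
    ∑ u : Fin m → κ, ∏ i, p (u i) = 1 := by
  classical
  have := Finset.prod_univ_sum (fun _ : Fin m => (Finset.univ : Finset κ)) (fun _ c => p c)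
  rw [Fintype.piFinset_univ] at this
  rw [← this, Finset.prod_congr rfl fun _ _ => hp, Finset.prod_const_one]

theorem sum_prod_weights_mul_sum {κ : Type*} [Fintype κ] {p g : κ → ℝ} (hp : ∑ c, p c = 1)
    (hg : ∑ c, p c * g c = 0) (m : ℕ) :
    ∑ u : Fin m → κ, (∏ i, p (u i)) * ∑ i, g (u i) = 0 := by
  induction m with
  | zero => simp
  | succ m ih =>
    rw [sum_fin_succ_fun]
    simp_rw [Fin.prod_univ_succ, Fin.sum_univ_succ, Fin.cons_zero, Fin.cons_succ, mul_add,
      Finset.sum_add_distrib]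
    have h1 : ∑ c, ∑ u : Fin m → κ, p c * (∏ i, p (u i)) * g c = 0 := by
      rw [← hg]
      refine Finset.sum_congr rfl fun c _ => ?_
      rw [← Finset.sum_mul, ← Finset.mul_sum, sum_prod_weights hp, mul_one]
    have h2 : ∀ c, ∑ u : Fin m → κ, p c * (∏ i, p (u i)) * ∑ i, g (u i) = 0 := by
      intro c
      simp_rw [mul_assoc]
      rw [← Finset.mul_sum, ih, mul_zero]
    rw [h1, Finset.sum_congr rfl fun c _ => h2 c]
    simp

theorem sum_prod_weights_mul_sum_sq {κ : Type*} [Fintype κ] {p g : κ → ℝ} (hp : ∑ c, p c = 1)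
    (hg : ∑ c, p c * g c = 0) (m : ℕ) :
    ∑ u : Fin m → κ, (∏ i, p (u i)) * (∑ i, g (u i)) ^ 2 = m * ∑ c, p c * g c ^ 2 := by
  induction m with
  | zero => simp
  | succ m ih =>
    rw [sum_fin_succ_fun]
    simp_rw [Fin.prod_univ_succ, Fin.sum_univ_succ, Fin.cons_zero, Fin.cons_succ]
    have h : ∀ c, ∑ u : Fin m → κ, p c * (∏ i, p (u i)) * (g c + ∑ i, g (u i)) ^ 2 =
        p c * g c ^ 2 + p c * (m * ∑ c, p c * g c ^ 2) := by
      intro c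
      have e : ∀ u : Fin m → κ, p c * (∏ i, p (u i)) * (g c + ∑ i, g (u i)) ^ 2 =
          p c * g c ^ 2 * (∏ i, p (u i)) + 2 * p c * g c * ((∏ i, p (u i)) * ∑ i, g (u i)) +
            p c * ((∏ i, p (u i)) * (∑ i, g (u i)) ^ 2) := fun u => by ring
      rw [Finset.sum_congr rfl fun u _ => e u, Finset.sum_add_distrib, Finset.sum_add_distrib,
        ← Finset.mul_sum, ← Finset.mul_sum, ← Finset.mul_sum, ih, sum_prod_weights hp,
        sum_prod_weights_mul_sum hp hg]
      ring
    rw [Finset.sum_congr rfl fun c _ => h c, Finset.sum_add_distrib, ← Finset.sum_mul, hp]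
    push_cast; ring

/-- Chebyshev's inequality for sums of independent variables. -/
theorem sum_prod_weights_filter_le {κ : Type*} [Fintype κ] {p g : κ → ℝ} (hp0 : ∀ c, 0 ≤ p c)
    (hp : ∑ c, p c = 1) (hg : ∑ c, p c * g c = 0) {m : ℕ} {T : ℝ} (hT : 0 < T)
    (S : Finset (Fin m → κ)) (hS : ∀ u ∈ S, T < |∑ i, g (u i)|) :
    ∑ u ∈ S, ∏ i, p (u i) ≤ m * (∑ c, p c * g c ^ 2) / T ^ 2 := by
  have hw : ∀ u : Fin m → κ, 0 ≤ ∏ i, p (u i) := fun u => Finset.prod_nonneg fun i _ => hp0 _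
  rw [le_div_iff₀ (by positivity), ← sum_prod_weights_mul_sum_sq hp hg, Finset.sum_mul]
  calc ∑ u ∈ S, (∏ i, p (u i)) * T ^ 2 ≤ ∑ u ∈ S, (∏ i, p (u i)) * (∑ i, g (u i)) ^ 2 := by
        refine Finset.sum_le_sum fun u hu => mul_le_mul_of_nonneg_left ?_ (hw u)
        rw [← sq_abs (∑ i, g (u i))]
        exact pow_le_pow_left₀ hT.le (hS u hu).le 2
    _ ≤ _ := Finset.sum_le_sum_of_subset_of_nonneg (Finset.subset_univ _) fun u _ _ =>
        mul_nonneg (hw u) (sq_nonneg _)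

end ProductWeights

/-! ### Distributions obtained from unnormalised weights -/

section NormalizedPMF
open scoped ENNReal

/-- The distribution on `{0, …, m - 1}` with masses proportional to `Y`. -/
noncomputable def normalizedPMF {m : ℕ} (Y : Fin m → ℝ) (hY : ∀ i, 0 ≤ Y i) (hs : 0 < ∑ i, Y i) :
    PMF ℕ :=
  PMF.ofFinset (fun i => if h : i < m then ENNReal.ofReal (Y ⟨i, h⟩ / ∑ i, Y i) else 0)
    (Finset.range m)
    (by
      rw [Finset.sum_range, Finset.sum_congr rfl (g := fun i => ENNReal.ofReal (Y i / ∑ i, Y i))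
        (fun i _ => dif_pos i.2), ← ENNReal.ofReal_sum_of_nonneg
        (fun i _ => div_nonneg (hY i) hs.le), ← Finset.sum_div, div_self hs.ne',
        ENNReal.ofReal_one])
    (fun i hi => dif_neg fun h => hi (Finset.mem_range.2 h))

variable {m : ℕ} {Y : Fin m → ℝ} (hY : ∀ i, 0 ≤ Y i) (hs : 0 < ∑ i, Y i)

theorem normalizedPMF_val (i : Fin m) :
    normalizedPMF Y hY hs i = ENNReal.ofReal (Y i / ∑ i, Y i) := by
  rw [normalizedPMF, PMF.ofFinset_apply, dif_pos i.2]

theorem exists_of_normalizedPMF_ne_zero {j : ℕ} (h : normalizedPMF Y hY hs j ≠ 0) :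
    ∃ i : Fin m, (i : ℕ) = j ∧ Y i ≠ 0 := by
  rw [normalizedPMF, PMF.ofFinset_apply] at h
  by_cases hj : j < m
  · refine ⟨⟨j, hj⟩, rfl, fun h0 => h ?_⟩
    rw [dif_pos hj, h0, zero_div, ENNReal.ofReal_zero]
  · exact absurd (dif_neg hj) h

theorem normalizedPMF_mem_distClass (h1 : ∀ i, Y i ≠ 0 → 1 ≤ Y i) {k : ℕ}
    (hk : ∑ i, Y i ≤ k) : normalizedPMF Y hY hs ∈ distClass k := by
  intro j hj
  obtain ⟨i, rfl, hi⟩ := exists_of_normalizedPMF_ne_zero hY hs hj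
  rw [normalizedPMF_val, ENNReal.toReal_ofReal (div_nonneg (hY i) hs.le)]
  exact div_le_div₀ (hY i) (h1 i hi) hs hk

theorem supportSize_normalizedPMF :
    supportSize (normalizedPMF Y hY hs) = (Finset.univ.filter fun i => Y i ≠ 0).card := by
  have h : (normalizedPMF Y hY hs).support =
      ((Finset.univ.filter fun i => Y i ≠ 0).map Fin.valEmbedding : Finset ℕ) := by
    ext j
    rw [PMF.mem_support_iff, Finset.mem_coe, Finset.mem_map]
    constructor
    · intro hj
      obtain ⟨i, hi, hi0⟩ := exists_of_normalizedPMF_ne_zero hY hs hj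
      exact ⟨i, Finset.mem_filter.2 ⟨Finset.mem_univ _, hi0⟩, hi⟩
    · rintro ⟨i, hi, rfl⟩
      have hi0 := (Finset.mem_filter.1 hi).2
      rw [Fin.valEmbedding_apply, normalizedPMF_val, Ne, ENNReal.ofReal_eq_zero, not_le]
      exact div_pos (lt_of_le_of_ne (hY i) (Ne.symm hi0)) hs
  rw [supportSize, h, Set.ncard_coe_finset, Finset.card_map]

open Classical in
-- The factor (∑ Y)ⁿ clears the normalisation. As only this inequality is needed, sequences with
-- symbols outside {0, …, m-1} can be ignored.
theorem sum_prod_le_sampleLaw {n : ℕ} (A : Set (Fin n → ℕ)) :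
    ∑ z ∈ Finset.univ.filter (fun z : Fin n → Fin m => (fun j => (z j : ℕ)) ∈ A), ∏ j, Y (z j) ≤
      (sampleLaw (normalizedPMF Y hY hs) n).real A * (∑ i, Y i) ^ n := by
  have : IsProbabilityMeasure (sampleLaw (normalizedPMF Y hY hs) n) := by
    unfold sampleLaw; infer_instance
  have h1 : ∀ z : Fin n → Fin m, ∏ j, Y (z j) =
      (sampleLaw (normalizedPMF Y hY hs) n).real {fun j => (z j : ℕ)} * (∑ i, Y i) ^ n := by
    intro z
    rw [sampleLaw, Measure.real, Measure.pi_singleton, ENNReal.toReal_prod]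
    simp_rw [PMF.toMeasure_apply_singleton _ _ (measurableSet_singleton _), normalizedPMF_val,
      ENNReal.toReal_ofReal (div_nonneg (hY _) hs.le)]
    rw [Finset.prod_div_distrib, Finset.prod_const, Finset.card_univ, Fintype.card_fin,
      div_mul_cancel₀ _ (pow_ne_zero _ hs.ne')]
  have hinj : Function.Injective fun (z : Fin n → Fin m) (j : Fin n) => (z j : ℕ) := by
    intro z z' h
    funext j
    exact Fin.ext (congrFun h j)
  rw [Finset.sum_congr rfl fun z _ => h1 z, ← Finset.sum_mul]
  refine mul_le_mul_of_nonneg_right ?_ (pow_nonneg hs.le _)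
  rw [← Finset.sum_image (f := fun y => (sampleLaw (normalizedPMF Y hY hs) n).real {y})
    hinj.injOn, sum_measureReal_singleton]
  refine measureReal_mono ?_
  intro y hy
  obtain ⟨z, hz, rfl⟩ := Finset.mem_image.1 (Finset.mem_coe.1 hy)
  exact (Finset.mem_filter.1 hz).2

end NormalizedPMF

/-! ### Poisson sample size -/

section Poissonization
open scoped Nat ENNReal

/-- The sequences of length `N ≥ n` whose first `n` terms form a sequence in `Φ`. -/
def extendSet {m n : ℕ} (Φ : Set (Fin n → Fin m)) (N : ℕ) : Set (Fin N → Fin m) :=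
  {x | ∃ h : n ≤ N, (fun j => x (Fin.castLE h j)) ∈ Φ}

open Classical in
theorem sum_extendSet {m n : ℕ} (Φ : Set (Fin n → Fin m)) (Y : Fin m → ℝ) (N : ℕ) :
    ∑ x ∈ Finset.univ.filter (· ∈ extendSet Φ N), ∏ j, Y (x j) =
      if n ≤ N then (∑ z ∈ Finset.univ.filter (· ∈ Φ), ∏ j, Y (z j)) * (∑ i, Y i) ^ (N - n)
      else 0 := by
  split_ifs with h
  · obtain ⟨r, rfl⟩ := Nat.exists_eq_add_of_le h
    rw [Nat.add_sub_cancel_left, Finset.sum_filter, ← (Fin.appendEquiv n r).sum_comp,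
      Fintype.sum_prod_type, Finset.sum_filter, Finset.sum_mul]
    refine Finset.sum_congr rfl fun z _ => ?_
    have hmem : ∀ w : Fin r → Fin m, (Fin.appendEquiv n r) (z, w) ∈ extendSet Φ (n + r) ↔
        z ∈ Φ := by
      intro w
      have e : ∀ h' : n ≤ n + r, (fun j => Fin.append z w (Fin.castLE h' j)) = z := by
        intro h'
        funext j
        exact Fin.append_left z w j
      constructor
      · rintro ⟨h', hz⟩
        have := e h'
        rwa [← this]
      · intro hz
        refine ⟨h, ?_⟩
        have := e h
        rw [← this] at hz
        exact hz
    simp only [hmem]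
    split_ifs
    · rw [← Fin.prod_const r, Finset.prod_univ_sum, Fintype.piFinset_univ, Finset.mul_sum]
      refine Finset.sum_congr rfl fun w _ => ?_
      rw [Fin.prod_univ_add]
      congr 1
      · exact Finset.prod_congr rfl fun j _ => congrArg Y (Fin.append_left z w j)
      · exact Finset.prod_congr rfl fun j _ => congrArg Y (Fin.append_right z w j)
    · simp
  · refine Finset.sum_eq_zero fun x hx => ?_
    obtain ⟨h', -⟩ := (Finset.mem_filter.1 hx).2
    exact absurd h' h

open Classical in
/-- The probability that a Poisson sample with intensities `lam * Y` has at least `n` terms, the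
first `n` of which form a sequence in `Φ`. -/
noncomputable def poissonizedProb {m n : ℕ} (Φ : Set (Fin n → Fin m)) (lam : ℝ) (Y : Fin m → ℝ) :
    ℝ≥0∞ :=
  ∑' N : ℕ, (N ! : ℝ≥0∞)⁻¹ * ∑ x ∈ Finset.univ.filter (· ∈ extendSet Φ N),
    ENNReal.ofReal (∏ i, (exp (-(lam * Y i)) * (lam * Y i) ^ countVec x i))

theorem ofReal_div_factorial (a : ℝ) (N : ℕ) :
    (N ! : ℝ≥0∞)⁻¹ * ENNReal.ofReal a = ENNReal.ofReal (a / N !) := by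
  rw [ENNReal.ofReal_div_of_pos (by positivity), ENNReal.ofReal_natCast, div_eq_mul_inv, mul_comm]

theorem tsum_ofReal_poissonTerm {x : ℝ} (hx : 0 ≤ x) :
    ∑' j, ENNReal.ofReal (poissonTerm j x) = 1 := by
  rw [← ENNReal.ofReal_tsum_of_nonneg (fun j => poissonTerm_nonneg j hx)
    (hasSum_poissonTerm x).summable, (hasSum_poissonTerm x).tsum_eq, ENNReal.ofReal_one]

open Classical in
-- The sample size is Poisson with mean λ∑Y and, given the size, the terms are i.i.d. with law Y/∑Y;
-- hence the two factors. Leaving Y unnormalised keeps the counts independent across symbols when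
-- the Yᵢ are drawn independently.
theorem poissonizedProb_eq {m n : ℕ} (Φ : Set (Fin n → Fin m)) {lam : ℝ} (hlam : 0 ≤ lam)
    {Y : Fin m → ℝ} (hY : ∀ i, 0 ≤ Y i) (hs : 0 < ∑ i, Y i) :
    poissonizedProb Φ lam Y = (∑' N, if n ≤ N then
      ENNReal.ofReal (poissonTerm N (lam * ∑ i, Y i)) else 0) *
        ENNReal.ofReal ((∑ z ∈ Finset.univ.filter (· ∈ Φ), ∏ j, Y (z j)) / (∑ i, Y i) ^ n) := by
  rw [poissonizedProb, ← ENNReal.tsum_mul_right]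
  refine tsum_congr fun N => ?_
  have h1 : ∀ x : Fin N → Fin m, ∏ i, (exp (-(lam * Y i)) * (lam * Y i) ^ countVec x i) =
      exp (-(lam * ∑ i, Y i)) * lam ^ N * ∏ j, Y (x j) := by
    intro x
    rw [Finset.prod_mul_distrib, ← Real.exp_sum, ← prod_comp_eq_prod_pow_countVec x
      (fun i => lam * Y i), Finset.prod_mul_distrib, Finset.prod_const, Finset.card_univ,
      Fintype.card_fin, Finset.sum_neg_distrib, ← Finset.mul_sum]
    ring
  rw [← ENNReal.ofReal_sum_of_nonneg (fun x _ => Finset.prod_nonneg fun i _ =>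
    mul_nonneg (exp_nonneg _) (pow_nonneg (mul_nonneg hlam (hY i)) _)),
    Finset.sum_congr rfl fun x _ => h1 x, ← Finset.mul_sum, sum_extendSet, ofReal_div_factorial]
  split_ifs with h
  · rw [← ENNReal.ofReal_mul (poissonTerm_nonneg _ (mul_nonneg hlam hs.le)), poissonTerm]
    congr 1
    have hs' : (∑ i, Y i) ^ N = (∑ i, Y i) ^ (N - n) * (∑ i, Y i) ^ n := by
      rw [← pow_add, Nat.sub_add_cancel h]
    rw [mul_pow, hs']
    field_simp
  · simp

theorem poissonizedProb_le_one {m n : ℕ} (Φ : Set (Fin n → Fin m)) {lam : ℝ} (hlam : 0 ≤ lam)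
    {Y : Fin m → ℝ} (hY : ∀ i, 0 ≤ Y i) : poissonizedProb Φ lam Y ≤ 1 := by
  classical
  have h0 : ∀ i, 0 ≤ lam * Y i := fun i => mul_nonneg hlam (hY i)
  calc poissonizedProb Φ lam Y ≤ ∑' N : ℕ, (N ! : ℝ≥0∞)⁻¹ * ∑ x : Fin N → Fin m,
      ENNReal.ofReal (∏ i, (exp (-(lam * Y i)) * (lam * Y i) ^ countVec x i)) := by
        refine ENNReal.tsum_le_tsum fun N => ?_
        gcongr
        exact Finset.subset_univ _
    _ = ∑' a : Fin m → ℕ, ∏ i, ENNReal.ofReal (poissonTerm (a i) (lam * Y i)) := by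
        rw [tsum_sum_countVec fun a => ENNReal.ofReal
          (∏ i, (exp (-(lam * Y i)) * (lam * Y i) ^ a i))]
        refine tsum_congr fun a => ?_
        rw [ENNReal.ofReal_prod_of_nonneg fun i _ =>
          mul_nonneg (exp_nonneg _) (pow_nonneg (h0 i) _), ← Finset.prod_mul_distrib]
        refine Finset.prod_congr rfl fun i _ => ?_
        rw [mul_comm, ofReal_div_factorial]
        rfl
    _ ≤ 1 := (tsum_prod_family_eq_one fun i => tsum_ofReal_poissonTerm (h0 i)).le

end Poissonization

/-! ### Mixtures over independent intensities -/

section Mixture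
open scoped Nat ENNReal

variable {κ : Type*} [Fintype κ]

open Classical in
-- Averaging over independent intensities turns the weight of a sequence into a product over symbols
-- of one-dimensional mixtures.
theorem sum_poissonizedProb {m n : ℕ} (Φ : Set (Fin n → Fin m)) {lam : ℝ} (hlam : 0 ≤ lam)
    {v p : κ → ℝ} (hv : ∀ c, 0 ≤ v c) (hp : ∀ c, 0 ≤ p c) :
    ∑ u : Fin m → κ, ENNReal.ofReal (∏ i, p (u i)) * poissonizedProb Φ lam (fun i => v (u i)) =
      ∑' N : ℕ, (N ! : ℝ≥0∞)⁻¹ * ∑ x ∈ Finset.univ.filter (· ∈ extendSet Φ N),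
        ENNReal.ofReal (∏ i, ∑ c, p c * (exp (-(lam * v c)) * (lam * v c) ^ countVec x i)) := by
  have h0 : ∀ c j, 0 ≤ exp (-(lam * v c)) * (lam * v c) ^ j := fun c j =>
    mul_nonneg (exp_nonneg _) (pow_nonneg (mul_nonneg hlam (hv c)) _)
  simp_rw [poissonizedProb, ← ENNReal.tsum_mul_left]
  rw [← Summable.tsum_finsetSum fun u _ => ENNReal.summable]
  refine tsum_congr fun N => ?_
  simp_rw [mul_left_comm _ (N ! : ℝ≥0∞)⁻¹, Finset.mul_sum]
  rw [Finset.sum_comm]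
  refine Finset.sum_congr rfl fun x _ => ?_
  rw [← Finset.mul_sum, Finset.prod_univ_sum, Fintype.piFinset_univ,
    ENNReal.ofReal_sum_of_nonneg fun u _ => Finset.prod_nonneg fun i _ =>
      mul_nonneg (hp _) (h0 _ _)]
  congr 1
  refine Finset.sum_congr rfl fun u _ => ?_
  rw [← ENNReal.ofReal_mul (Finset.prod_nonneg fun i _ => hp _), ← Finset.prod_mul_distrib]

/-- The event depends on the order of the sample, but the weights only on the counts. The excess is
therefore bounded by a sum over all sequences, which `tsum_sum_countVec` converts to the ℓ¹ distance
of product laws. -/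
theorem sum_poissonizedProb_le {m n : ℕ} (Φ : Set (Fin n → Fin m)) {lam : ℝ} (hlam : 0 ≤ lam)
    {v p q : κ → ℝ} (hv : ∀ c, 0 ≤ v c) (hp : ∀ c, 0 ≤ p c) (hq : ∀ c, 0 ≤ q c)
    (hp1 : ∑ c, p c = 1) (hq1 : ∑ c, q c = 1) :
    ∑ u : Fin m → κ, ENNReal.ofReal (∏ i, p (u i)) * poissonizedProb Φ lam (fun i => v (u i)) ≤
      ∑ u : Fin m → κ, ENNReal.ofReal (∏ i, q (u i)) * poissonizedProb Φ lam (fun i => v (u i)) +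
      m * ∑' j, ENNReal.ofReal
        |∑ c, p c * poissonTerm j (lam * v c) - ∑ c, q c * poissonTerm j (lam * v c)| := by
  classical
  have h0 : ∀ c, 0 ≤ lam * v c := fun c => mul_nonneg hlam (hv c)
  have hmix : ∀ r : κ → ℝ, (∀ c, 0 ≤ r c) → ∑ c, r c = 1 →
      ∑' j, ENNReal.ofReal (∑ c, r c * poissonTerm j (lam * v c)) = 1 := by
    intro r hr hr1
    simp_rw [ENNReal.ofReal_sum_of_nonneg fun c _ => mul_nonneg (hr c) (poissonTerm_nonneg _ (h0 c)),
      ENNReal.ofReal_mul (hr _)]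
    rw [Summable.tsum_finsetSum fun u _ => ENNReal.summable]
    simp_rw [ENNReal.tsum_mul_left, tsum_ofReal_poissonTerm (h0 _), mul_one]
    rw [← ENNReal.ofReal_sum_of_nonneg fun c _ => hr c, hr1, ENNReal.ofReal_one]
  have hfac : ∀ (r : κ → ℝ) (a : Fin m → ℕ),
      ∏ i, ∑ c, r c * poissonTerm (a i) (lam * v c) =
        (∏ i, ∑ c, r c * (exp (-(lam * v c)) * (lam * v c) ^ a i)) / ∏ i, ((a i)! : ℝ) := by
    intro r a
    rw [← Finset.prod_div_distrib]
    refine Finset.prod_congr rfl fun i _ => ?_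
    rw [Finset.sum_div]
    refine Finset.sum_congr rfl fun c _ => ?_
    simp only [poissonTerm]
    ring
  set α : (κ → ℝ) → (Fin m → ℕ) → ℝ := fun r a =>
    ∏ i, ∑ c, r c * (exp (-(lam * v c)) * (lam * v c) ^ a i) with hα
  rw [sum_poissonizedProb Φ hlam hv hp, sum_poissonizedProb Φ hlam hv hq]
  calc _ ≤ ∑' N : ℕ, ((N ! : ℝ≥0∞)⁻¹ * ∑ x ∈ Finset.univ.filter (· ∈ extendSet Φ N),
        ENNReal.ofReal (α q (countVec x)) + (N ! : ℝ≥0∞)⁻¹ * ∑ x : Fin N → Fin m,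
        ENNReal.ofReal |α p (countVec x) - α q (countVec x)|) := by
        refine ENNReal.tsum_le_tsum fun N => ?_
        rw [← mul_add]
        gcongr
        calc _ ≤ ∑ x ∈ Finset.univ.filter (· ∈ extendSet Φ N),
            (ENNReal.ofReal (α q (countVec x)) +
              ENNReal.ofReal |α p (countVec x) - α q (countVec x)|) := by
              refine Finset.sum_le_sum fun x _ => ?_
              refine le_trans (ENNReal.ofReal_le_ofReal ?_) ENNReal.ofReal_add_le
              have := le_abs_self (α p (countVec x) - α q (countVec x))
              simp only [hα] at this ⊢
              linarith
          _ ≤ _ := by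
              rw [Finset.sum_add_distrib]
              gcongr
              exact Finset.subset_univ _
    _ ≤ _ := by
        rw [ENNReal.tsum_add, tsum_sum_countVec fun a => ENNReal.ofReal |α p a - α q a|]
        refine add_le_add le_rfl ?_
        refine le_trans (le_of_eq ?_) (tsum_abs_prod_sub_prod_le
          (f := fun j => ∑ c, p c * poissonTerm j (lam * v c))
          (g := fun j => ∑ c, q c * poissonTerm j (lam * v c))
          (fun j => Finset.sum_nonneg fun c _ => mul_nonneg (hp c) (poissonTerm_nonneg _ (h0 c)))
          (fun j => Finset.sum_nonneg fun c _ => mul_nonneg (hq c) (poissonTerm_nonneg _ (h0 c)))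
          (hmix p hp hp1) (hmix q hq hq1) m)
        refine tsum_congr fun a => ?_
        have hpos : 0 < ∏ i, ((a i)! : ℝ) := Finset.prod_pos fun i _ => by positivity
        rw [hfac, hfac, ← sub_div, abs_div, abs_of_pos hpos, ENNReal.ofReal_div_of_pos hpos,
          div_eq_mul_inv]
        congr 1
        rw [ENNReal.ofReal_prod_of_nonneg fun i _ => by positivity, ← ENNReal.prod_inv_distrib]
        · simp_rw [ENNReal.ofReal_natCast]
        · exact fun i _ j _ _ => Or.inr (ENNReal.natCast_ne_top _)

end Mixture

/-! ### The testing argument -/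

section Core
open scoped Nat ENNReal

theorem poisson_tail {μ : ℝ} (hμ : 0 ≤ μ) {n : ℕ} {ε : ℝ}
    (h : ∑ N ∈ Finset.range n, poissonTerm N μ ≤ ε) :
    ENNReal.ofReal (1 - ε) ≤ ∑' N, if n ≤ N then ENNReal.ofReal (poissonTerm N μ) else 0 := by
  have h1 : (1 : ℝ≥0∞) = ∑ N ∈ Finset.range n, ENNReal.ofReal (poissonTerm N μ) +
      ∑' N, if n ≤ N then ENNReal.ofReal (poissonTerm N μ) else 0 := by
    rw [← tsum_ofReal_poissonTerm hμ]
    have h2 : ∑ N ∈ Finset.range n, ENNReal.ofReal (poissonTerm N μ) =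
        ∑' N, if N < n then ENNReal.ofReal (poissonTerm N μ) else 0 := by
      rw [tsum_eq_sum (s := Finset.range n) fun N hN => if_neg fun h => hN (Finset.mem_range.2 h)]
      exact Finset.sum_congr rfl fun N hN => (if_pos (Finset.mem_range.1 hN)).symm
    rw [h2, ← ENNReal.tsum_add]
    refine tsum_congr fun N => ?_
    by_cases hN : n ≤ N
    · rw [if_pos hN, if_neg (not_lt.2 hN), zero_add]
    · rw [if_neg hN, if_pos (not_le.1 hN), add_zero]
  rw [← ENNReal.ofReal_sum_of_nonneg fun N _ => poissonTerm_nonneg N hμ] at h1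
  have hε : 0 ≤ ε := (Finset.sum_nonneg fun N _ => poissonTerm_nonneg N hμ).trans h
  rw [ENNReal.ofReal_sub _ hε, ENNReal.ofReal_one, tsub_le_iff_left, h1]
  gcongr

/-- Bound on the weight of the configurations with atypical total mass or atypical number of
nonzero entries. -/
theorem sum_atypical_le {K m : ℕ} {v p : Fin (K + 1) → ℝ} {B ν t : ℝ} (hm : 0 < m) (hν : 0 < ν)
    (ht : 0 < t) (hv : ∀ c, 0 ≤ v c ∧ v c ≤ B) (hp : ∀ c, 0 ≤ p c) (hp1 : ∑ c, p c = 1)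
    (hmean : ∑ c, p c * v c = 1) (S : Finset (Fin m → Fin (K + 1)))
    (hS : ∀ u ∈ S, ν * m < |∑ i, v (u i) - m| ∨
      t < |((Finset.univ.filter fun i => u i ≠ 0).card : ℝ) - m * (1 - p 0)|) :
    ∑ u ∈ S, ∏ i, p (u i) ≤ B / (ν ^ 2 * m) + m / t ^ 2 := by
  classical
  have hm' : (0 : ℝ) < m := by exact_mod_cast hm
  have hw : ∀ u : Fin m → Fin (K + 1), 0 ≤ ∏ i, p (u i) := fun u =>
    Finset.prod_nonneg fun i _ => hp _
  set g₁ : Fin (K + 1) → ℝ := fun c => v c - 1 with hg₁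
  set g₂ : Fin (K + 1) → ℝ := fun c => (if c ≠ 0 then 1 else 0) - (1 - p 0) with hg₂
  have hc1 : ∑ c, p c * g₁ c = 0 := by
    simp only [hg₁, mul_sub, mul_one, Finset.sum_sub_distrib, hmean, hp1, sub_self]
  have hp0 : ∑ c, p c * (if c ≠ 0 then (1 : ℝ) else 0) = 1 - p 0 := by
    have e := Fin.sum_univ_succ p
    rw [hp1] at e
    rw [Fin.sum_univ_succ]
    simp
    linarith
  have hc2 : ∑ c, p c * g₂ c = 0 := by
    simp only [hg₂, mul_sub (p _) _ (1 - p 0), Finset.sum_sub_distrib, hp0, ← Finset.sum_mul, hp1]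
    ring
  -- The variance is at most E v² ≤ B · E v = B.
  have hv1 : ∑ c, p c * g₁ c ^ 2 ≤ B := by
    have e : ∑ c, p c * g₁ c ^ 2 = ∑ c, p c * v c ^ 2 - 1 := by
      have : ∀ c, p c * g₁ c ^ 2 = p c * v c ^ 2 - 2 * (p c * v c) + p c := fun c => by
        simp only [hg₁]; ring
      rw [Finset.sum_congr rfl fun c _ => this c, Finset.sum_add_distrib, Finset.sum_sub_distrib,
        ← Finset.mul_sum, hmean, hp1]
      ring
    have h2 : ∑ c, p c * v c ^ 2 ≤ ∑ c, B * (p c * v c) := by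
      refine Finset.sum_le_sum fun c _ => ?_
      have := mul_le_mul_of_nonneg_left (hv c).2 (mul_nonneg (hp c) (hv c).1)
      linarith
    rw [← Finset.mul_sum, hmean] at h2
    linarith
  have hv2 : ∑ c, p c * g₂ c ^ 2 ≤ 1 := by
    have hp01 : p 0 ≤ 1 := hp1 ▸ Finset.single_le_sum (fun c _ => hp c) (Finset.mem_univ 0)
    rw [← hp1]
    refine Finset.sum_le_sum fun c _ => mul_le_of_le_one_right (hp c) ?_
    rw [sq_le_one_iff_abs_le_one, abs_le]
    simp only [hg₂]
    split_ifs <;> constructor <;> linarith [hp 0]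
  have hs1 : ∀ u : Fin m → Fin (K + 1), ∑ i, g₁ (u i) = ∑ i, v (u i) - m := fun u => by
    simp [hg₁]
  have hs2 : ∀ u : Fin m → Fin (K + 1), ∑ i, g₂ (u i) =
      ((Finset.univ.filter fun i => u i ≠ 0).card : ℝ) - m * (1 - p 0) := fun u => by
    simp only [hg₂]
    rw [Finset.sum_sub_distrib, Finset.sum_boole, Finset.sum_const, Finset.card_univ,
      Fintype.card_fin, nsmul_eq_mul]
  have b1 := sum_prod_weights_filter_le hp hp1 hc1 (mul_pos hν hm')
    (S.filter fun u => ν * m < |∑ i, v (u i) - m|)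
    (fun u hu => by rw [hs1]; exact (Finset.mem_filter.1 hu).2)
  have b2 := sum_prod_weights_filter_le hp hp1 hc2 ht
    (S.filter fun u => t < |((Finset.univ.filter fun i => u i ≠ 0).card : ℝ) - m * (1 - p 0)|)
    (fun u hu => by rw [hs2]; exact (Finset.mem_filter.1 hu).2)
  calc ∑ u ∈ S, ∏ i, p (u i) ≤ _ + _ := by
        rw [← Finset.sum_filter_add_sum_filter_not S
          (fun u => ν * m < |∑ i, v (u i) - m|)]
        refine add_le_add le_rfl (Finset.sum_le_sum_of_subset_of_nonneg ?_ fun u _ _ => hw u)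
        intro u hu
        obtain ⟨hu1, hu2⟩ := Finset.mem_filter.1 hu
        exact Finset.mem_filter.2 ⟨hu1, (hS u hu1).resolve_left hu2⟩
    _ ≤ _ := add_le_add b1 b2
    _ ≤ _ := by
        refine add_le_add ?_ ?_
        · calc _ ≤ m * B / (ν * m) ^ 2 := by gcongr
            _ = _ := by field_simp
        · calc _ ≤ m * 1 / t ^ 2 := by gcongr
            _ = _ := by rw [mul_one]

open Classical in
/-- If the parameters satisfy these inequalities, then `n` samples do not suffice. -/
theorem not_succeeds {b : ℝ} (hb : 1 < b) {l k m n : ℕ} {ν lam ε t : ℝ} (hm : 0 < m) (hν : 0 < ν)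
    (hν1 : ν < 1) (ht : 0 < t) (hlam : 0 < lam) (hk : (1 + ν) * m ≤ k)
    (hsep : 2 * (ε * k) + 2 * t ≤ m * ((b - 1) / (b + 1)) ^ (l + 2))
    (hvar : b ^ 2 / (ν ^ 2 * m) + m / t ^ 2 ≤ 0.1)
    (htail : ∀ μ, lam * ((1 - ν) * m) ≤ μ → ∑ N ∈ Finset.range n, poissonTerm N μ ≤ 0.1)
    (hTV : m * (4 * (lam * b ^ 2 + 2) * (lam * b ^ 2 / 2) ^ (l + 3) / (l + 3)!) ≤ 0.1)
    (Shat : (Fin n → ℕ) → ℤ) : ¬ Succeeds k ε n Shat := by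
  intro hS
  obtain ⟨v, p, q, hv0, hv1, hp, hq, hp1, hq1, hmean, hmom, hsep'⟩ := exists_moment_matching hb l
  have hm' : (0 : ℝ) < m := by exact_mod_cast hm
  have hvnn : ∀ c, 0 ≤ v c := fun c => by
    by_cases h : c = 0
    · rw [h, hv0]
    · linarith [(hv1 c h).1]
  have hvB : ∀ c, v c ≤ b ^ 2 := fun c => by
    by_cases h : c = 0
    · rw [h, hv0]; positivity
    · exact (hv1 c h).2
  have hvne : ∀ c, v c ≠ 0 ↔ c ≠ 0 := fun c => by
    constructor
    · rintro h rfl; exact h hv0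
    · intro h; linarith [(hv1 c h).1]
  have hmeanq : ∑ c, q c * v c = 1 := by
    have := hmom 1 (by omega)
    simp only [pow_one] at this
    rw [← this, hmean]
  set C : (Fin m → Fin (l + 4)) → ℝ := fun u => ((Finset.univ.filter fun i => u i ≠ 0).card : ℝ)
    with hC
  set good : (Fin (l + 4) → ℝ) → (Fin m → Fin (l + 4)) → Prop := fun r u =>
    |∑ i, v (u i) - m| ≤ ν * m ∧ |C u - m * (1 - r 0)| ≤ t with hgood
  -- Typical supports have size at most θ - εk under `q` and, by `hsep` and `hsep'`, at least θ + εk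
  -- under `p`. So if the test Ŝ ≥ θ is wrong, Ŝ is off by at least εk.
  set θ : ℝ := m * (1 - q 0) + t + ε * k with hθ
  set A : Set (Fin n → ℕ) := {x | θ ≤ Shat x} with hA
  set Φ : Set (Fin n → Fin m) := {z | (fun j => (z j : ℕ)) ∈ A} with hΦ
  have hmass : ∀ r u, good r u → (1 - ν) * m ≤ ∑ i, v (u i) ∧ ∑ i, v (u i) ≤ k := by
    intro r u h
    have := abs_le.1 h.1
    constructor <;> nlinarith [this.1, this.2]
  have hmass0 : ∀ r u, good r u → 0 < ∑ i, v (u i) := fun r u h =>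
    lt_of_lt_of_le (mul_pos (by linarith) hm') (hmass r u h).1
  have hfail : ∀ u, 0 < ∑ i, v (u i) → ∑ i, v (u i) ≤ k → ∀ A' : Set (Fin n → ℕ),
      (∀ x ∈ A', ε * k ≤ |(Shat x : ℝ) - C u|) →
      ∑ z ∈ Finset.univ.filter (fun z : Fin n → Fin m => (fun j => (z j : ℕ)) ∈ A'),
        ∏ j, v (u (z j)) ≤ 0.1 * (∑ i, v (u i)) ^ n := by
    intro u hs hsk A' hA'
    have hP := normalizedPMF_mem_distClass (Y := fun i => v (u i)) (fun i => hvnn _) hs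
      (fun i hi => (hv1 _ ((hvne _).1 hi)).1) hsk
    refine (sum_prod_le_sampleLaw (Y := fun i => v (u i)) (fun i => hvnn _) hs A').trans ?_
    refine mul_le_mul_of_nonneg_right (le_trans ?_ (hS _ hP)) (pow_nonneg hs.le n)
    have : IsProbabilityMeasure
        (sampleLaw (normalizedPMF (fun i => v (u i)) (fun i => hvnn _) hs) n) := by
      unfold sampleLaw; infer_instance
    refine measureReal_mono fun x hx => ?_
    rw [Set.mem_ofPred_eq, supportSize_normalizedPMF]
    simp only [hvne]
    exact hA' x hx
  have hbadw : ∀ r : Fin (l + 4) → ℝ, (∀ c, 0 ≤ r c) → ∑ c, r c = 1 → ∑ c, r c * v c = 1 →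
      ∑ u ∈ Finset.univ.filter (fun u => ¬ good r u), ∏ i, r (u i) ≤ 0.1 := by
    intro r hr hr1 hrm
    refine (sum_atypical_le hm hν ht (fun c => ⟨hvnn c, hvB c⟩) hr hr1 hrm _ ?_).trans hvar
    intro u hu
    have h := (Finset.mem_filter.1 hu).2
    simp only [hgood, not_and_or, not_le] at h
    exact h
  have hw : ∀ r : Fin (l + 4) → ℝ, (∀ c, 0 ≤ r c) → ∀ u : Fin m → Fin (l + 4),
      0 ≤ ∏ i, r (u i) := fun r hr u => Finset.prod_nonneg fun i _ => hr _
  -- upper bound for the small supports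
  have hupper : ∑ u : Fin m → Fin (l + 4), ENNReal.ofReal (∏ i, q (u i)) *
      poissonizedProb Φ lam (fun i => v (u i)) ≤ ENNReal.ofReal 0.2 := by
    have h1 : ∀ u, good q u → poissonizedProb Φ lam (fun i => v (u i)) ≤ ENNReal.ofReal 0.1 := by
      intro u hu
      have hs := hmass0 q u hu
      rw [poissonizedProb_eq Φ hlam.le (fun i => hvnn _) hs]
      refine le_trans (mul_le_of_le_one_left' ?_) (ENNReal.ofReal_le_ofReal ?_)
      · rw [← tsum_ofReal_poissonTerm (mul_nonneg hlam.le hs.le)]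
        refine ENNReal.tsum_le_tsum fun N => ?_
        split_ifs
        · exact le_rfl
        · exact zero_le
      · rw [div_le_iff₀ (pow_pos hs n)]
        refine hfail u hs (hmass q u hu).2 A fun x hx => ?_
        have h2 := (abs_le.1 hu.2).2
        have h3 : θ ≤ Shat x := hx
        refine le_trans ?_ (le_abs_self _)
        linarith
    calc _ ≤ ∑ u : Fin m → Fin (l + 4), ENNReal.ofReal ((∏ i, q (u i)) * 0.1 +
          if good q u then 0 else ∏ i, q (u i)) := by
          refine Finset.sum_le_sum fun u _ => ?_
          by_cases hu : good q u
          · rw [if_pos hu, add_zero, ENNReal.ofReal_mul (hw q hq u)]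
            gcongr
            exact h1 u hu
          · rw [if_neg hu]
            refine le_trans (mul_le_of_le_one_right' (poissonizedProb_le_one Φ hlam.le
              fun i => hvnn _)) (ENNReal.ofReal_le_ofReal ?_)
            have := hw q hq u
            linarith
      _ ≤ _ := by
          rw [← ENNReal.ofReal_sum_of_nonneg fun u _ => add_nonneg
            (mul_nonneg (hw q hq u) (by norm_num)) (by split_ifs; exacts [le_rfl, hw q hq u])]
          refine ENNReal.ofReal_le_ofReal ?_
          rw [Finset.sum_add_distrib, ← Finset.sum_mul, sum_prod_weights hq1]
          have h2 := hbadw q hq hq1 hmeanq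
          rw [Finset.sum_filter] at h2
          simp only [ite_not] at h2
          linarith
  -- lower bound for the large supports
  have hlower : ENNReal.ofReal 0.7 ≤ ∑ u : Fin m → Fin (l + 4), ENNReal.ofReal (∏ i, p (u i)) *
      poissonizedProb Φ lam (fun i => v (u i)) := by
    -- 0.9 for having at least n terms, times 0.9 for the test being right. Atypical `u` then leave
    -- 0.9 · 0.81 > 0.7.
    have h1 : ∀ u, good p u → ENNReal.ofReal 0.81 ≤ poissonizedProb Φ lam (fun i => v (u i)) := by
      intro u hu
      have hs := hmass0 p u hu
      rw [poissonizedProb_eq Φ hlam.le (fun i => hvnn _) hs]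
      have ha : ENNReal.ofReal 0.9 ≤ ∑' N, if n ≤ N then
          ENNReal.ofReal (poissonTerm N (lam * ∑ i, v (u i))) else 0 := by
        have := poisson_tail (mul_nonneg hlam.le hs.le)
          (htail _ (mul_le_mul_of_nonneg_left (hmass p u hu).1 hlam.le))
        norm_num at this ⊢
        exact this
      have hbb : ENNReal.ofReal 0.9 ≤ ENNReal.ofReal
          ((∑ z ∈ Finset.univ.filter (· ∈ Φ), ∏ j, v (u (z j))) / (∑ i, v (u i)) ^ n) := by
        refine ENNReal.ofReal_le_ofReal ?_
        rw [le_div_iff₀ (pow_pos hs n)]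
        have h2 := hfail u hs (hmass p u hu).2 Aᶜ (fun x hx => by
          have h2 := (abs_le.1 hu.2).1
          have h3 : (Shat x : ℝ) < θ := not_le.1 hx
          have h4 : (m : ℝ) * ((b - 1) / (b + 1)) ^ (l + 2) ≤ m * (q 0 - p 0) :=
            mul_le_mul_of_nonneg_left hsep' hm'.le
          refine le_trans ?_ (neg_le_abs _)
          linarith)
        have h3 := Finset.sum_filter_add_sum_filter_not Finset.univ
          (fun z : Fin n → Fin m => z ∈ Φ) (fun z => ∏ j, v (u (z j)))
        have h4 : ∑ z : Fin n → Fin m, ∏ j, v (u (z j)) = (∑ i, v (u i)) ^ n := by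
          rw [← Fin.prod_const n, Finset.prod_univ_sum, Fintype.piFinset_univ]
        have h5 : ∑ z ∈ Finset.univ.filter (fun z : Fin n → Fin m => ¬ z ∈ Φ),
            ∏ j, v (u (z j)) ≤ 0.1 * (∑ i, v (u i)) ^ n := by
          refine le_trans (le_of_eq (Finset.sum_congr ?_ fun _ _ => rfl)) h2
          ext z
          simp [hΦ]
        rw [h4] at h3
        linarith
      refine le_trans (le_of_eq ?_) (mul_le_mul' ha hbb)
      rw [← ENNReal.ofReal_mul (by norm_num)]
      norm_num
    calc _ ≤ ∑ u : Fin m → Fin (l + 4), ENNReal.ofReal (if good p u then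
          (∏ i, p (u i)) * 0.81 else 0) := by
          rw [← ENNReal.ofReal_sum_of_nonneg fun u _ => by
            split_ifs; exacts [mul_nonneg (hw p hp u) (by norm_num), le_rfl]]
          refine ENNReal.ofReal_le_ofReal ?_
          have h2 := hbadw p hp hp1 hmean
          have h3 := Finset.sum_filter_add_sum_filter_not Finset.univ
            (fun u => good p u) (fun u => ∏ i, p (u i))
          rw [sum_prod_weights hp1] at h3
          rw [← Finset.sum_filter, ← Finset.sum_mul]
          linarith
      _ ≤ _ := by
          refine Finset.sum_le_sum fun u _ => ?_
          split_ifs with hu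
          · rw [ENNReal.ofReal_mul (hw p hp u)]
            gcongr
            exact h1 u hu
          · simp
  have hTV' := tsum_abs_poisson_mixture_le (V := fun c => lam * v c) (p := p) (q := q)
    (M := lam * b ^ 2) (n := l + 2) (by positivity)
    (fun c => ⟨mul_nonneg hlam.le (hvnn c), mul_le_mul_of_nonneg_left (hvB c) hlam.le⟩)
    hp hq hp1 hq1 (fun j hj => by
      have h := hmom j hj
      have e : ∀ r : Fin (l + 4) → ℝ, ∑ c, r c * (lam * v c) ^ j = lam ^ j * ∑ c, r c * v c ^ j := by
        intro r
        rw [Finset.mul_sum]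
        exact Finset.sum_congr rfl fun c _ => by rw [mul_pow]; ring
      rw [e, e, h])
  have hfinal := hlower.trans (sum_poissonizedProb_le Φ hlam.le hvnn hp hq hp1 hq1)
  have hend : ENNReal.ofReal 0.7 ≤ ENNReal.ofReal (0.2 + 0.1) := by
    refine hfinal.trans ?_
    rw [ENNReal.ofReal_add (by norm_num) (by norm_num)]
    refine add_le_add hupper ?_
    calc (m : ℝ≥0∞) * _ ≤ ENNReal.ofReal m * ENNReal.ofReal
          (4 * (lam * b ^ 2 + 2) * (lam * b ^ 2 / 2) ^ (l + 3) / (l + 3)!) := by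
          rw [ENNReal.ofReal_natCast]
          gcongr
      _ ≤ _ := by
          rw [← ENNReal.ofReal_mul hm'.le]
          exact ENNReal.ofReal_le_ofReal hTV
  rw [ENNReal.ofReal_le_ofReal_iff (by norm_num)] at hend
  norm_num at hend

end Core

/-! ### Choice of the parameters -/

section Parameters
open scoped Nat

/-- Exponential tilting to the mean zμ with z = e^(-η/4). The resulting exponent is at most -η²W/(16
+ 4η) ≤ -60/20 = -3, and e^(-3) < 0.1. -/
theorem poisson_chernoff {η W μ : ℝ} {n : ℕ} (hη : 0 < η) (hη1 : η ≤ 1)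
    (hμ : (1 + η / 2) * W ≤ μ) (hn : (n : ℝ) ≤ W) (hW : 60 ≤ W * η ^ 2) :
    ∑ N ∈ Finset.range n, poissonTerm N μ ≤ 0.1 := by
  have hW0 : 0 < W := by nlinarith [sq_nonneg η]
  have hμ0 : 0 ≤ μ := le_trans (by positivity) hμ
  set z := exp (-(η / 4)) with hz
  have h1 : ∀ N ∈ Finset.range n, poissonTerm N μ ≤
      exp (-(1 - z) * μ + η / 4 * n) * poissonTerm N (z * μ) := by
    intro N hN
    have hNn : (N : ℝ) ≤ n := by exact_mod_cast (Finset.mem_range.1 hN).le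
    have e : exp (-(1 - z) * μ + η / 4 * n) * poissonTerm N (z * μ) =
        poissonTerm N μ * exp (η / 4 * (n - N)) := by
      have e1 : z ^ N = exp (-(η / 4 * N)) := by rw [hz, ← exp_nat_mul]; congr 1; ring
      have e2 : exp (-(1 - z) * μ + η / 4 * n) * (exp (-(z * μ)) * exp (-(η / 4 * N))) =
          exp (-μ) * exp (η / 4 * (n - N)) := by
        rw [← exp_add, ← exp_add, ← exp_add]; congr 1; ring
      unfold poissonTerm
      rw [mul_pow, e1]
      calc _ = exp (-(1 - z) * μ + η / 4 * n) * (exp (-(z * μ)) * exp (-(η / 4 * N))) *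
            μ ^ N / N ! := by ring
        _ = _ := by rw [e2]; ring
    rw [e]
    refine le_mul_of_one_le_right (poissonTerm_nonneg N hμ0) (one_le_exp ?_)
    exact mul_nonneg (by positivity) (by linarith)
  have h2 : ∑ N ∈ Finset.range n, poissonTerm N (z * μ) ≤ 1 :=
    sum_le_hasSum _ (fun N _ => poissonTerm_nonneg N (by positivity)) (hasSum_poissonTerm _)
  have h3 : η / 4 / (1 + η / 4) ≤ 1 - z := by
    have : z ≤ 1 / (1 + η / 4) := by
      rw [hz, exp_neg, one_div]
      exact inv_anti₀ (by positivity) (by linarith [add_one_le_exp (η / 4)])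
    have e : η / 4 / (1 + η / 4) = 1 - 1 / (1 + η / 4) := by field_simp; ring
    linarith
  have h4 : -(1 - z) * μ + η / 4 * n ≤ -3 := by
    have h5 : η / 4 / (1 + η / 4) * ((1 + η / 2) * W) ≤ (1 - z) * μ := by
      have : 0 ≤ η / 4 / (1 + η / 4) := by positivity
      exact mul_le_mul h3 hμ (by positivity) (by linarith)
    have h6 : η / 4 / (1 + η / 4) * ((1 + η / 2) * W) - η / 4 * W =
        η ^ 2 * W / (16 + 4 * η) := by field_simp; ring
    have h7 : 3 ≤ η ^ 2 * W / (16 + 4 * η) := by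
      rw [le_div_iff₀ (by positivity)]; nlinarith
    have h8 : η / 4 * n ≤ η / 4 * W := by gcongr
    linarith
  calc _ ≤ ∑ N ∈ Finset.range n, exp (-(1 - z) * μ + η / 4 * n) * poissonTerm N (z * μ) :=
        Finset.sum_le_sum h1
    _ ≤ exp (-3) * 1 := by
        rw [← Finset.mul_sum]
        exact mul_le_mul (exp_le_exp.2 h4) h2
          (Finset.sum_nonneg fun N _ => poissonTerm_nonneg N (by positivity)) (exp_nonneg _)
    _ ≤ 0.1 := by
        have h := exp_one_gt_d9
        have e : exp 3 = exp 1 ^ 3 := by rw [← exp_nat_mul]; norm_num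
        have : (10 : ℝ) ≤ exp 3 := by
          rw [e]
          calc (10 : ℝ) ≤ 2.7 ^ 3 := by norm_num
            _ ≤ _ := by gcongr; linarith
        rw [mul_one, exp_neg, inv_le_comm₀ (exp_pos _) (by norm_num)]
        linarith

/-- By log u ≤ u - 1, log((b+1)/(b-1)) ≤ 2/(b-1) = (1-η)ℓ/L with ℓ = log(1/x), so the power is at
least x e^(ηℓ), and ℓ ≥ 1 - x. The excess ηx(1-x) will pay for fluctuations and for m < k. -/
theorem separation_le_pow {η x : ℝ} {L : ℕ} (hη : 0 < η) (hη1 : η < 1) (hx : 0 < x) (hx1 : x < 1)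
    (hL : 0 < L) {b : ℝ} (hb : b = 1 + 2 * L / ((1 - η) * log (1 / x))) :
    x + η * x * (1 - x) ≤ ((b - 1) / (b + 1)) ^ L := by
  have hlog : log (1 / x) = -log x := by rw [one_div, log_inv]
  have hl : 1 - x ≤ log (1 / x) := by
    rw [hlog]; linarith [log_le_sub_one_of_pos hx]
  set ℓ := log (1 / x) with hℓ
  have hl0 : 0 < ℓ := by linarith
  have hL' : (0 : ℝ) < L := by exact_mod_cast hL
  have hη2 : 0 < 1 - η := by linarith
  have hb1 : 0 < b - 1 := by rw [hb, add_sub_cancel_left]; positivity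
  have hb2 : 0 < b + 1 := by linarith
  have h1 : -((1 - η) * ℓ) ≤ L * log ((b - 1) / (b + 1)) := by
    have h2 : log ((b + 1) / (b - 1)) ≤ (b + 1) / (b - 1) - 1 :=
      log_le_sub_one_of_pos (by positivity)
    have h3 : (b + 1) / (b - 1) - 1 = (1 - η) * ℓ / L := by
      have : (b + 1) / (b - 1) - 1 = 2 / (b - 1) := by field_simp; ring
      rw [this, hb, add_sub_cancel_left]
      field_simp
    have h4 : log ((b + 1) / (b - 1)) = -log ((b - 1) / (b + 1)) := by
      rw [← log_inv, inv_div]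
    rw [h3, h4] at h2
    have h5 := mul_le_mul_of_nonneg_left h2 hL'.le
    have h6 : (L : ℝ) * ((1 - η) * ℓ / L) = (1 - η) * ℓ := by field_simp
    linarith
  have hxe : x = exp (-ℓ) := by rw [hlog, neg_neg, exp_log hx]
  calc x + η * x * (1 - x) = x * (1 + η * (1 - x)) := by ring
    _ ≤ x * exp (η * ℓ) := by
        refine mul_le_mul_of_nonneg_left ?_ hx.le
        have := add_one_le_exp (η * ℓ)
        nlinarith
    _ = exp (-((1 - η) * ℓ)) := by
        have e : -((1 - η) * ℓ) = -ℓ + η * ℓ := by ring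
        rw [e, exp_add, ← hxe]
    _ ≤ exp (L * log ((b - 1) / (b + 1))) := exp_le_exp.2 h1
    _ = _ := by rw [exp_nat_mul, exp_log (by positivity)]

/-- This is Nᴺ/N! ≤ eᴺ at N = L + 1. -/
theorem pow_div_factorial_le_exp_neg {M s : ℝ} {L : ℕ} (hM : 0 ≤ M) (hs : 0 ≤ s)
    (h : M ≤ L * (2 / exp 1 * exp (-s))) :
    (M / 2) ^ (L + 1) / (L + 1)! ≤ exp (-(s * L)) := by
  have h1 := pow_div_factorial_le_exp ((L + 1 : ℕ) : ℝ) (Nat.cast_nonneg _) (L + 1)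
  have hpos : (0 : ℝ) < ((L + 1 : ℕ) : ℝ) := by positivity
  have hbase : M / 2 ≤ ((L + 1 : ℕ) : ℝ) * (exp (-1) * exp (-s)) := by
    have h2 : (L : ℝ) ≤ ((L + 1 : ℕ) : ℝ) := by push_cast; linarith
    calc M / 2 ≤ L * (2 / exp 1 * exp (-s)) / 2 := by linarith
      _ = L * (exp (-1) * exp (-s)) := by rw [exp_neg 1]; ring
      _ ≤ _ := by gcongr
  calc (M / 2) ^ (L + 1) / (L + 1)!
      ≤ (((L + 1 : ℕ) : ℝ) * (exp (-1) * exp (-s))) ^ (L + 1) / (L + 1)! := by gcongr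
    _ = ((L + 1 : ℕ) : ℝ) ^ (L + 1) / (L + 1)! * (exp (-1) * exp (-s)) ^ (L + 1) := by
        rw [mul_pow]; ring
    _ ≤ exp ((L + 1 : ℕ) : ℝ) * (exp (-1) * exp (-s)) ^ (L + 1) := by gcongr
    _ = exp (-(s * ((L + 1 : ℕ) : ℝ))) := by
        rw [← exp_add, ← exp_nat_mul, ← exp_add]; congr 1; ring
    _ ≤ _ := by
        rw [exp_le_exp]; push_cast; nlinarith

set_option maxHeartbeats 1000000 in
/-- The lower bound for parameters in the admissible range, once `log k` is large. -/
theorem not_succeeds_of_le {η γ κ ρ : ℝ} (hη : 0 < η) (hη1 : η < 1) (hγ : 0 < γ) (hκ : 0 ≤ κ)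
    (hρ : 0 < ρ) (hS : (1 + η) ^ 3 * γ * ρ * (2 / (1 - η) + κ) ^ 2 ≤
      2 / exp 1 * exp (-((1 + η) / γ))) {k : ℕ} (hω1 : 1 < γ * log k) (hω2 : 1 ≤ γ * log k * η)
    (hω3 : 4 * (γ * log k + 3) * exp (-(η * log k)) ≤ 0.1)
    (hω4 : 60 ≤ 4 * ρ * γ ^ 2 * log k * η ^ 2) {x : ℝ} (hx : 0 < x) (hx1 : x < 1)
    (hℓ : log (1 / x) ≤ κ * γ * log k)
    (hkey : (1 + 2 * (⌈γ * log k⌉₊ : ℝ) / ((1 - η) * log (1 / x))) ^ 2 ≤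
      k * (η * x * (1 - x)) ^ 2 / 1280) {n : ℕ} (hn : (n : ℝ) ≤ ρ * k * log (1 / x) ^ 2 / log k)
    (Shat : (Fin n → ℕ) → ℤ) : ¬ Succeeds k (x / 2) n Shat := by
  have hη2 : 0 < 1 - η := by linarith
  have hl : 1 - x ≤ log (1 / x) := by
    rw [one_div, log_inv]; linarith [log_le_sub_one_of_pos hx]
  have hsep0 := fun {L : ℕ} (hL : 0 < L) => separation_le_pow hη hη1 hx hx1 hL rfl
  set ω := log k with hω
  set ℓ := log (1 / x) with hℓd
  have hl0 : 0 < ℓ := by linarith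
  have hω0 : 0 < ω := by
    by_contra h
    have := mul_nonpos_of_nonneg_of_nonpos hγ.le (not_lt.1 h)
    linarith
  set L := ⌈γ * ω⌉₊ with hL
  have hLω : γ * ω ≤ L := Nat.le_ceil _
  have hLω' : (L : ℝ) < γ * ω + 1 := Nat.ceil_lt_add_one (by positivity)
  have hL2 : 2 ≤ L := by
    have : (1 : ℝ) < L := by linarith
    exact_mod_cast this
  obtain ⟨l, hl2⟩ := Nat.exists_eq_add_of_le' hL2
  have hL0 : (0 : ℝ) < L := by linarith
  have hsep1 := hsep0 (L := L) (by omega)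
  set b := 1 + 2 * (L : ℝ) / ((1 - η) * ℓ) with hb
  have hb1 : 1 < b := by
    rw [hb]
    have : 0 < 2 * (L : ℝ) / ((1 - η) * ℓ) := by positivity
    linarith
  set Δ := η * x * (1 - x) with hΔ
  have hx2 : 0 < 1 - x := by linarith
  have hΔ0 : 0 < Δ := by positivity
  have hxx : x * (1 - x) ≤ 1 / 4 := by linarith [sq_nonneg (x - 1 / 2)]
  have hΔη : Δ ≤ η / 4 := by
    rw [hΔ, mul_assoc]; linarith [mul_le_mul_of_nonneg_left hxx hη.le]
  have hkΔ : 1280 ≤ k * Δ ^ 2 := by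
    have : 1 ≤ b ^ 2 := one_le_pow₀ hb1.le
    linarith
  have hk0 : (0 : ℝ) < k := by
    by_contra h
    have : (k : ℝ) * Δ ^ 2 ≤ 0 := mul_nonpos_of_nonpos_of_nonneg (not_lt.1 h) (sq_nonneg _)
    linarith
  have hkΔ1 : 1280 ≤ k * Δ := by
    have : k * Δ ^ 2 ≤ k * Δ := by
      have : Δ ^ 2 ≤ Δ := by rw [sq]; exact mul_le_of_le_one_left hΔ0.le (by linarith)
      gcongr
    linarith
  -- Of the slack kΔ, about kΔ/4 goes to m < k and kΔ/4 to 2t with t = kΔ/8; the rest covers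
  -- rounding.
  set ν := Δ / 4 with hν
  have hν0 : 0 < ν := by positivity
  set m := ⌊(k : ℝ) / (1 + ν)⌋₊ with hm
  have hm1 : (m : ℝ) ≤ k / (1 + ν) := Nat.floor_le (by positivity)
  have hm2 : (k : ℝ) / (1 + ν) < m + 1 := Nat.lt_floor_add_one _
  have hkm : (1 + ν) * m ≤ k := by
    rw [le_div_iff₀ (by positivity)] at hm1; linarith
  have hm3 : k * (1 - ν) - 1 ≤ m := by
    have : (k : ℝ) * (1 - ν) ≤ k / (1 + ν) := by
      rw [le_div_iff₀ (by positivity)]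
      linarith [mul_pos hk0 (mul_pos hν0 hν0)]
    linarith
  have hmk : (m : ℝ) ≤ k := by
    have : 0 ≤ ν * m := by positivity
    linarith
  have hkη : 1280 ≤ k * (η / 4) := hkΔ1.trans (by gcongr)
  have hνη : ν ≤ η / 16 := by rw [hν]; linarith
  have hm4 : k * (1 - η / 8) ≤ m := by
    have := mul_le_mul_of_nonneg_left hνη hk0.le
    linarith
  have hmhalf : (k : ℝ) / 2 ≤ m := by
    have := mul_le_mul_of_nonneg_left hη1.le hk0.le
    linarith
  have hm0 : (0 : ℝ) < m := by linarith
  have hkm' : (k : ℝ) ≤ (1 + η) * m := by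
    have h1 : (1 + η) * (k * (1 - η / 8)) ≤ (1 + η) * m := by gcongr
    have h2 : (1 : ℝ) ≤ (1 + η) * (1 - η / 8) := by linarith [mul_le_mul_of_nonneg_left hη1.le hη.le]
    have h3 := mul_le_mul_of_nonneg_left h2 hk0.le
    linarith
  set W := ρ * k * ℓ ^ 2 / ω with hW
  have hW0 : 0 < W := by positivity
  have hW1 : 60 ≤ W * η ^ 2 := by
    have h1 : 2 * (L : ℝ) / ℓ ≤ b := by
      have : 2 * (L : ℝ) / ℓ ≤ 2 * (L : ℝ) / ((1 - η) * ℓ) := by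
        gcongr
        exact mul_le_of_le_one_left hl0.le (by linarith)
      linarith
    have h2 : (2 * (L : ℝ) / ℓ) ^ 2 ≤ k := by
      calc (2 * (L : ℝ) / ℓ) ^ 2 ≤ b ^ 2 := by gcongr
        _ ≤ k * Δ ^ 2 / 1280 := hkey
        _ ≤ k * 1 / 1280 := by gcongr; exact pow_le_one₀ hΔ0.le (by linarith)
        _ ≤ k := by linarith
    rw [div_pow, div_le_iff₀ (by positivity)] at h2
    have h3 : 4 * (γ * ω) ^ 2 ≤ k * ℓ ^ 2 := by
      calc 4 * (γ * ω) ^ 2 ≤ 4 * (L : ℝ) ^ 2 := by gcongr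
        _ = (2 * (L : ℝ)) ^ 2 := by ring
        _ ≤ _ := h2
    have h4 : 4 * ρ * γ ^ 2 * ω ≤ W := by
      rw [hW, le_div_iff₀ hω0]
      calc 4 * ρ * γ ^ 2 * ω * ω = ρ * (4 * (γ * ω) ^ 2) := by ring
        _ ≤ ρ * (k * ℓ ^ 2) := by gcongr
        _ = _ := by ring
    calc (60 : ℝ) ≤ 4 * ρ * γ ^ 2 * ω * η ^ 2 := hω4
      _ ≤ _ := by gcongr
  -- Oversampling by 1 + η keeps the Poisson mean above (1 + η/2)W even when the total mass is only
  -- (1-ν)m.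
  set lam := (1 + η) * W / m with hlam
  have hlam0 : 0 < lam := by positivity
  have hM : lam * b ^ 2 ≤ L * (2 / exp 1 * exp (-((1 + η) / γ))) := by
    have h1 : ℓ * b ≤ L * (2 / (1 - η) + κ) := by
      have e : ℓ * b = ℓ + L * (2 / (1 - η)) := by rw [hb]; field_simp
      rw [e]
      have : κ * (γ * ω) ≤ κ * L := by gcongr
      linarith
    have h2 : (L : ℝ) ≤ γ * (1 + η) * ω := by linarith
    have e : lam * b ^ 2 = (1 + η) * ρ * (k / m) * ((ℓ * b) ^ 2 / ω) := by
      rw [hlam, hW]; field_simp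
    rw [e]
    -- The three factors 1 + η in `hS` come from `lam`, from k/m and from the ceiling in `L`.
    calc (1 + η) * ρ * (k / m) * ((ℓ * b) ^ 2 / ω)
        ≤ (1 + η) * ρ * (1 + η) * ((L * (2 / (1 - η) + κ)) ^ 2 / ω) := by
          have : (k : ℝ) / m ≤ 1 + η := by rw [div_le_iff₀ hm0]; exact hkm'
          gcongr
      _ = (1 + η) ^ 2 * ρ * (2 / (1 - η) + κ) ^ 2 * L * (L / ω) := by ring
      _ ≤ (1 + η) ^ 2 * ρ * (2 / (1 - η) + κ) ^ 2 * L * (γ * (1 + η)) := by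
          have : (L : ℝ) / ω ≤ γ * (1 + η) := by rw [div_le_iff₀ hω0]; exact h2
          gcongr
      _ = L * ((1 + η) ^ 3 * γ * ρ * (2 / (1 - η) + κ) ^ 2) := by ring
      _ ≤ _ := by gcongr
  have hML : lam * b ^ 2 ≤ L := by
    refine hM.trans (mul_le_of_le_one_right hL0.le ?_)
    refine mul_le_one₀ ?_ (exp_nonneg _) (exp_le_one_iff.2 (by
      have : 0 < (1 + η) / γ := by positivity
      linarith))
    rw [div_le_one (exp_pos _)]
    linarith [add_one_le_exp 1]
  refine not_succeeds hb1 (l := l) (m := m) (ν := ν) (lam := lam) (t := k * Δ / 8)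
    (by exact_mod_cast hm0) hν0 (by linarith) (by positivity) hlam0 hkm ?_ ?_ ?_ ?_ Shat
  · rw [← hl2]
    have h1 : (m : ℝ) * (x + Δ) ≤ m * ((b - 1) / (b + 1)) ^ L :=
      mul_le_mul_of_nonneg_left hsep1 hm0.le
    have h2 : x + Δ ≤ 1 := by
      have : Δ ≤ 1 * x * (1 - x) := by rw [hΔ]; gcongr
      linarith [sq_nonneg (1 - x)]
    have h3 : (k * (1 - ν) - 1) * (x + Δ) ≤ m * (x + Δ) := by gcongr
    have h4 : (k * ν + 1) * (x + Δ) ≤ k * ν + 1 := mul_le_of_le_one_right (by positivity) h2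
    have h5 : k * ν = k * Δ / 4 := by rw [hν]; ring
    linarith
  · have h1 : b ^ 2 / (ν ^ 2 * m) ≤ 0.05 := by
      rw [div_le_iff₀ (by positivity)]
      have : Δ ^ 2 / 16 * (k / 2) ≤ ν ^ 2 * m := by
        have e : ν ^ 2 = Δ ^ 2 / 16 := by rw [hν]; ring
        rw [e]; gcongr
      linarith
    -- The constant 1280 is 64/0.05.
    have h2 : (m : ℝ) / (k * Δ / 8) ^ 2 ≤ 0.05 := by
      rw [div_le_iff₀ (by positivity)]
      have e : (k * Δ / 8) ^ 2 = k * (k * Δ ^ 2) / 64 := by ring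
      rw [e]
      have : (k : ℝ) * 1280 ≤ k * (k * Δ ^ 2) := by gcongr
      linarith
    linarith
  · intro μ hμ
    refine poisson_chernoff hη hη1.le (le_trans ?_ hμ) hn hW1
    have e : lam * ((1 - ν) * m) = (1 + η) * (1 - ν) * W := by rw [hlam]; field_simp
    rw [e]
    refine mul_le_mul_of_nonneg_right ?_ hW0.le
    have := mul_le_mul_of_nonneg_right hη1.le hν0.le
    linarith
  · have h1 := pow_div_factorial_le_exp_neg (M := lam * b ^ 2) (by positivity)
      (by positivity : 0 ≤ (1 + η) / γ) hM
    have e3 : l + 3 = L + 1 := by omega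
    rw [e3]
    -- Of the decay k^(-(1+η)), one power of k absorbs the m symbols and k^(-η) absorbs the factor
    -- of order log k.
    have h2 : exp (-((1 + η) / γ * L)) ≤ exp (-(η * ω)) / k := by
      have e : exp (-(η * ω)) / k = exp (-(η * ω) - ω) := by
        rw [exp_sub, hω, exp_log hk0]
      rw [e, exp_le_exp]
      have : (1 + η) / γ * (γ * ω) ≤ (1 + η) / γ * L := by gcongr
      have e4 : (1 + η) / γ * (γ * ω) = (1 + η) * ω := by field_simp
      linarith
    calc m * (4 * (lam * b ^ 2 + 2) * (lam * b ^ 2 / 2) ^ (L + 1) / (L + 1)!)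
        = m * (4 * (lam * b ^ 2 + 2)) * ((lam * b ^ 2 / 2) ^ (L + 1) / (L + 1)!) := by ring
      _ ≤ k * (4 * (γ * ω + 3)) * (exp (-(η * ω)) / k) := by
          have h3 : lam * b ^ 2 + 2 ≤ γ * ω + 3 := by linarith
          have h4 : 0 ≤ lam * b ^ 2 + 2 := by positivity
          exact mul_le_mul (mul_le_mul hmk (by linarith) (by linarith) hk0.le) (h1.trans h2)
            (by positivity) (mul_nonneg hk0.le (by linarith))
      _ = 4 * (γ * ω + 3) * exp (-(η * ω)) := by field_simp
      _ ≤ 0.1 := hω3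

end Parameters

/-! ### Splitting an error into three vanishing rates -/

section Rates

/-- The rate at `a` is the infimum of 1 and of those 1/(j+1) for which `A j a` holds. -/
theorem exists_rate {α : Type*} {F : Filter α} {A : ℕ → α → Prop} (hA : ∀ j, ∀ᶠ a in F, A j a) :
    ∃ f : α → ℝ, Tendsto f F (𝓝 0) ∧ ∀ a, 0 ≤ f a ∧
      ∀ r, f a < r → 1 < r ∨ ∃ j : ℕ, 1 / ((j : ℝ) + 1) < r ∧ A j a := by
  set S : α → Set ℝ := fun a => insert 1 {r | ∃ j : ℕ, A j a ∧ r = 1 / ((j : ℝ) + 1)} with hS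
  have hS0 : ∀ a, ∀ r ∈ S a, 0 ≤ r := by
    rintro a r (rfl | ⟨j, -, rfl⟩)
    · exact zero_le_one
    · positivity
  have hne : ∀ a, (S a).Nonempty := fun a => ⟨1, Set.mem_insert _ _⟩
  have hf0 : ∀ a, 0 ≤ sInf (S a) := fun a => le_csInf (hne a) (hS0 a)
  refine ⟨fun a => sInf (S a), ?_, fun a => ⟨hf0 a, fun r hr => ?_⟩⟩
  · rw [Metric.tendsto_nhds]
    intro ε hε
    obtain ⟨j, hj⟩ := exists_nat_one_div_lt hε
    filter_upwards [hA j] with a ha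
    rw [dist_zero_right, norm_of_nonneg (hf0 a)]
    exact (csInf_le ⟨0, hS0 a⟩ (Set.mem_insert_of_mem _ ⟨j, ha, rfl⟩)).trans_lt hj
  · obtain ⟨s, hs, hsr⟩ := exists_lt_of_csInf_lt (hne a) hr
    rcases hs with rfl | ⟨j, hj, rfl⟩
    · exact Or.inl hsr
    · exact Or.inr ⟨j, hsr, hj⟩

/-- A number r above the sum of the nonnegative rates exceeds each of them, so either r > 1 and `he`
applies, or each condition holds at a level with 1/(j+1) < r. The conditions are made cumulative in
j, so all three hold at the least of these levels. -/
theorem exists_rates {ι : Type*} {δ τ e : ι → ℝ} {κ : ι → ℕ} (he : ∀ i, e i ≤ 1)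
    (h : ∀ ζ : ℝ, 0 < ζ → ∃ d : ℝ, 0 < d ∧ ∃ K : ℕ, ∃ t : ℝ, 0 < t ∧
      ∀ i, δ i < d → K ≤ κ i → τ i < t → e i ≤ ζ) :
    ∃ (oδ : ℝ → ℝ) (ok : ℕ → ℝ) (oτ : ℝ → ℝ), Tendsto oδ (𝓝[>] 0) (𝓝 0) ∧
      Tendsto ok atTop (𝓝 0) ∧ Tendsto oτ (𝓝[>] 0) (𝓝 0) ∧
      ∀ i, e i ≤ oδ (δ i) + ok (κ i) + oτ (τ i) := by
  choose d hd K t ht hi using fun j : ℕ => h (1 / ((j : ℝ) + 1)) (by positivity)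
  have hsmall : ∀ s : ℕ → ℝ, (∀ j, 0 < s j) → ∀ j, ∀ᶠ x in 𝓝[>] (0 : ℝ),
      ∀ i ∈ Finset.range (j + 1), x < s i := fun s hs j =>
    (Finset.eventually_all _).2 fun i _ => by
      filter_upwards [Ioo_mem_nhdsGT (hs i)] with x hx using hx.2
  obtain ⟨f, hf, hf'⟩ := exists_rate (hsmall d hd)
  obtain ⟨g, hg, hg'⟩ := exists_rate (F := atTop)
    (A := fun j k => ∀ i ∈ Finset.range (j + 1), K i ≤ k)
    (fun j => (Finset.eventually_all _).2 fun i _ => eventually_ge_atTop (K i))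
  obtain ⟨o, ho, ho'⟩ := exists_rate (hsmall t ht)
  refine ⟨f, g, o, hf, hg, ho, fun i => le_of_forall_gt_imp_ge_of_dense fun r hr => ?_⟩
  obtain ⟨hf0, hf1⟩ := hf' (δ i)
  obtain ⟨hg0, hg1⟩ := hg' (κ i)
  obtain ⟨ho0, ho1⟩ := ho' (τ i)
  rcases hf1 r (by linarith) with h1 | ⟨j₁, hj₁, ha₁⟩
  · exact (he i).trans h1.le
  rcases hg1 r (by linarith) with h1 | ⟨j₂, hj₂, ha₂⟩
  · exact (he i).trans h1.le
  rcases ho1 r (by linarith) with h1 | ⟨j₃, hj₃, ha₃⟩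
  · exact (he i).trans h1.le
  set j := min j₁ (min j₂ j₃) with hj
  have hjr : 1 / ((j : ℝ) + 1) < r := by
    rcases min_choice j₁ (min j₂ j₃) with h1 | h1
    · rwa [hj, h1]
    · rcases min_choice j₂ j₃ with h2 | h2
      · rwa [hj, h1, h2]
      · rwa [hj, h1, h2]
  refine le_trans (hi j i (ha₁ j ?_) (ha₂ j ?_) (ha₃ j ?_)) hjr.le <;>
  · rw [Finset.mem_range]; omega

end Rates

/-! ### From failing estimators to the sample complexity -/

section Bounds

theorem Succeeds.mono {k n : ℕ} {ε ε' : ℝ} (h : ε ≤ ε') {Shat : (Fin n → ℕ) → ℤ}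
    (hS : Succeeds k ε n Shat) : Succeeds k ε' n Shat := by
  intro P hP
  have : IsProbabilityMeasure (sampleLaw P n) := by unfold sampleLaw; infer_instance
  refine (measureReal_mono fun x hx => ?_).trans (hS P hP)
  exact le_trans (mul_le_mul_of_nonneg_right h (Nat.cast_nonneg k)) hx

theorem le_sampleComplexity {k : ℕ} (hk : 0 < k) {ε W : ℝ} (hε : 0 < ε)
    (h : ∀ n : ℕ, (n : ℝ) ≤ W → ∀ Shat : (Fin n → ℕ) → ℤ, ¬ Succeeds k ε n Shat) :
    W ≤ sampleComplexity k ε := by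
  by_contra hlt
  obtain ⟨Shat, hS⟩ : sampleComplexity k ε ∈
      {n : ℕ | ∃ Shat : (Fin n → ℕ) → ℤ, Succeeds k ε n Shat} :=
    Nat.sInf_mem (exists_succeeds hk hε)
  exact h _ (not_le.1 hlt).le Shat hS

theorem sampleComplexity_antitone {k : ℕ} (hk : 0 < k) {ε ε' : ℝ} (hε : 0 < ε) (h : ε ≤ ε') :
    sampleComplexity k ε' ≤ sampleComplexity k ε := by
  obtain ⟨Shat, hS⟩ : sampleComplexity k ε ∈
      {n : ℕ | ∃ Shat : (Fin n → ℕ) → ℤ, Succeeds k ε n Shat} :=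
    Nat.sInf_mem (exists_succeeds hk hε)
  exact Nat.sInf_le ⟨Shat, hS.mono h⟩

theorem tendsto_log_natCast : Tendsto (fun k : ℕ => log k) atTop atTop :=
  tendsto_log_atTop.comp tendsto_natCast_atTop_atTop

theorem eventually_affine_mul_exp_le {a c r s : ℝ} (hr : 0 < r) (hs : 0 < s) (d : ℕ) :
    ∀ᶠ ω : ℝ in atTop, (a * ω ^ d + c) * exp (-(r * ω)) ≤ s := by
  have h1 : Tendsto (fun ω : ℝ => (r * ω) ^ d * exp (-(r * ω))) atTop (𝓝 0) :=
    (tendsto_pow_mul_exp_neg_atTop_nhds_zero d).comp (tendsto_id.const_mul_atTop hr)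
  have h2 : Tendsto (fun ω : ℝ => exp (-(r * ω))) atTop (𝓝 0) :=
    tendsto_exp_neg_atTop_nhds_zero.comp (tendsto_id.const_mul_atTop hr)
  have h3 := (h1.const_mul (a / r ^ d)).add (h2.const_mul c)
  rw [mul_zero, mul_zero, add_zero] at h3
  filter_upwards [h3.eventually_le_const hs] with ω hω
  refine le_trans (le_of_eq ?_) hω
  rw [mul_pow]
  field_simp

/-- The lower bound for parameters in the admissible range. -/
theorem exists_le_sampleComplexity {η γ κ ρ : ℝ} (hη : 0 < η) (hη1 : η < 1) (hγ : 0 < γ)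
    (hκ : 0 ≤ κ) (hρ : 0 < ρ) (hS : (1 + η) ^ 3 * γ * ρ * (2 / (1 - η) + κ) ^ 2 ≤
      2 / exp 1 * exp (-((1 + η) / γ))) :
    ∃ ω₀ : ℝ, 0 < ω₀ ∧ ∀ k : ℕ, ω₀ ≤ log k → ∀ ε : ℝ, 0 < ε → ε < 1 / 2 →
      log (1 / (2 * ε)) ≤ κ * γ * log k → ∀ A : ℝ,
      log (1 / (2 * ε)) + 2 / (1 - η) * (⌈γ * log k⌉₊ : ℝ) ≤ A * (2 * γ * log k) →
      1280 * (A * (2 * γ * log k)) ^ 2 ≤ k * (η * (2 * ε)) ^ 2 * (1 - 2 * ε) ^ 4 →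
      ρ * (k / log k) * log (1 / (2 * ε)) ^ 2 ≤ sampleComplexity k ε := by
  have e1 : ∀ᶠ ω : ℝ in atTop, 1 < γ * ω :=
    (tendsto_id.const_mul_atTop hγ).eventually_gt_atTop 1
  have e2 : ∀ᶠ ω : ℝ in atTop, 1 ≤ γ * ω * η :=
    ((tendsto_id.const_mul_atTop hγ).atTop_mul_const hη).eventually_ge_atTop 1
  have e3 : ∀ᶠ ω : ℝ in atTop, 4 * (γ * ω + 3) * exp (-(η * ω)) ≤ 0.1 := by
    filter_upwards [eventually_affine_mul_exp_le (a := 4 * γ) (c := 12) hη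
      (by norm_num : (0 : ℝ) < 0.1) 1] with ω hω
    refine le_trans (le_of_eq ?_) hω
    ring
  have e4 : ∀ᶠ ω : ℝ in atTop, 60 ≤ 4 * ρ * γ ^ 2 * ω * η ^ 2 := by
    have h : 0 < 4 * ρ * γ ^ 2 := by positivity
    exact ((tendsto_id.const_mul_atTop h).atTop_mul_const (by positivity : 0 < η ^ 2)
      ).eventually_ge_atTop 60
  obtain ⟨ω₀, hω₀⟩ := eventually_atTop.1 (e1.and (e2.and (e3.and (e4.and (eventually_gt_atTop 0)))))
  refine ⟨max ω₀ 1, by positivity, fun k hk ε hε hε1 hκℓ A hA hkey => ?_⟩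
  obtain ⟨f1, f2, f3, f4, f5⟩ := hω₀ (log k) ((le_max_left _ _).trans hk)
  have hk0 : 0 < k := by
    rcases Nat.eq_zero_or_pos k with rfl | h
    · simp at f5
    · exact h
  have hk0' : (0 : ℝ) < k := by exact_mod_cast hk0
  have hx : 0 < 2 * ε := by linarith
  have hx1 : 2 * ε < 1 := by linarith
  have hη2 : 0 < 1 - η := by linarith
  have hl : 1 - 2 * ε ≤ log (1 / (2 * ε)) := by
    rw [one_div, log_inv]; linarith [log_le_sub_one_of_pos hx]
  have hl0 : 0 < log (1 / (2 * ε)) := by linarith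
  have hk2 : (1 + 2 * (⌈γ * log k⌉₊ : ℝ) / ((1 - η) * log (1 / (2 * ε)))) ^ 2 ≤
      k * (η * (2 * ε) * (1 - 2 * ε)) ^ 2 / 1280 := by
    set ℓ := log (1 / (2 * ε))
    have hx2 : 0 < 1 - 2 * ε := by linarith
    -- The denominator uses ℓ ≥ 1 - 2ε. Squared, it joins the (1-2ε)² of the slack to form the
    -- fourth power behind the k^(1/4) in τ.
    have g1 : 1 + 2 * (⌈γ * log k⌉₊ : ℝ) / ((1 - η) * ℓ) ≤
        A * (2 * γ * log k) / (1 - 2 * ε) := by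
      have e : 1 + 2 * (⌈γ * log k⌉₊ : ℝ) / ((1 - η) * ℓ) =
          (ℓ + 2 / (1 - η) * (⌈γ * log k⌉₊ : ℝ)) / ℓ := by field_simp
      rw [e]
      have h0 : 0 ≤ ℓ + 2 / (1 - η) * (⌈γ * log k⌉₊ : ℝ) := by positivity
      exact div_le_div₀ (h0.trans hA) hA hx2 hl
    refine (pow_le_pow_left₀ (by positivity) g1 2).trans ?_
    rw [div_pow, div_le_div_iff₀ (by positivity) (by norm_num)]
    linarith
  refine le_sampleComplexity hk0 hε fun n hn Shat => ?_
  have hn' : (n : ℝ) ≤ ρ * k * log (1 / (2 * ε)) ^ 2 / log k := by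
    refine hn.trans (le_of_eq ?_); ring
  have := not_succeeds_of_le hη hη1 hγ hκ hρ hS f1 f2 f3 f4 hx hx1 hκℓ hk2 hn' Shat
  rwa [mul_div_cancel_left₀ ε two_ne_zero] at this

/-- Case γ = 1, κ = η. The largest admissible ρ is continuous in η and tends to (2/e)e^(-1)/4 =
1/(2e²) as η → 0. -/
theorem exists_rho {ζ : ℝ} (hζ : 0 < ζ) : ∃ η ρ : ℝ, 0 < η ∧ η < 1 ∧ 0 < ρ ∧
    (1 + η) ^ 3 * 1 * ρ * (2 / (1 - η) + η) ^ 2 ≤ 2 / exp 1 * exp (-((1 + η) / 1)) ∧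
    (1 - ζ) * (1 / (2 * exp 1 ^ 2)) ≤ ρ := by
  set R : ℝ → ℝ := fun η => 2 / exp 1 * exp (-((1 + η) / 1)) /
    ((1 + η) ^ 3 * 1 * (2 / (1 - η) + η) ^ 2) with hR
  have hc : ContinuousAt R 0 := by
    have h1 : ContinuousAt (fun η : ℝ => 2 / (1 - η)) 0 :=
      continuousAt_const.div (continuousAt_const.sub continuousAt_id) (by norm_num)
    refine ContinuousAt.div (by fun_prop) (ContinuousAt.mul (by fun_prop)
      ((h1.add continuousAt_id).pow 2)) (by norm_num)
  have hR0 : R 0 = 1 / (2 * exp 1 ^ 2) := by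
    simp only [hR]
    rw [add_zero, div_one, exp_neg]
    field_simp
    norm_num
  have hlt : (1 - ζ) * (1 / (2 * exp 1 ^ 2)) < R 0 := by
    rw [hR0]
    have : 0 < 1 / (2 * exp 1 ^ 2) := by positivity
    nlinarith
  have h2 : ∀ᶠ η in 𝓝[>] (0 : ℝ), (1 - ζ) * (1 / (2 * exp 1 ^ 2)) < R η :=
    (hc.eventually_const_lt hlt).filter_mono nhdsWithin_le_nhds
  obtain ⟨η, hη, hη01⟩ := (h2.and (Ioo_mem_nhdsGT (zero_lt_one' ℝ))).exists
  have hη0 : 0 < η := hη01.1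
  have hη1 : 0 < 1 - η := by linarith [hη01.2]
  refine ⟨η, R η, hη0, hη01.2, by simp only [hR]; positivity, le_of_eq ?_, hη.le⟩
  simp only [hR]
  field_simp

end Bounds

/-! ### The sharp and the uniform lower bounds -/

section MainBounds

/-- One of x and 1 - x is at least 1/2, so only the other factor needs a hypothesis. -/
theorem key_of_cases {k η a x : ℝ} (hk : 0 < k) (hη : 0 < η) (hx : 0 < x) (hx1 : x < 1)
    (h1 : 1 / 2 ≤ x → 1280 * a ^ 2 * 4 ≤ k * η ^ 2 * (1 - x) ^ 4)
    (h2 : x < 1 / 2 → 1280 * a ^ 2 * 16 ≤ k * η ^ 2 * x ^ 2) :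
    1280 * a ^ 2 ≤ k * (η * x) ^ 2 * (1 - x) ^ 4 := by
  have hx2 : 0 < 1 - x := by linarith
  rcases le_or_gt (1 / 2) x with h | h
  · have h3 : (1 / 2 : ℝ) ^ 2 ≤ x ^ 2 := by gcongr
    have h4 : k * η ^ 2 * (1 - x) ^ 4 * (1 / 2) ^ 2 ≤ k * η ^ 2 * (1 - x) ^ 4 * x ^ 2 := by gcongr
    have h5 : k * (η * x) ^ 2 * (1 - x) ^ 4 = k * η ^ 2 * (1 - x) ^ 4 * x ^ 2 := by ring
    rw [h5]
    linarith [h1 h]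
  · have h3 : (1 / 2 : ℝ) ^ 4 ≤ (1 - x) ^ 4 := by gcongr; linarith
    have h4 : k * η ^ 2 * x ^ 2 * (1 / 2) ^ 4 ≤ k * η ^ 2 * x ^ 2 * (1 - x) ^ 4 := by gcongr
    have h5 : k * (η * x) ^ 2 * (1 - x) ^ 4 = k * η ^ 2 * x ^ 2 * (1 - x) ^ 4 := by ring
    rw [h5]
    linarith [h2 h]

theorem sqrt_log_div_pow_four {k : ℝ} (hk : 1 ≤ k) :
    (√(log k) / k ^ (1 / 4 : ℝ)) ^ 4 = log k ^ 2 / k := by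
  have h1 : √(log k) ^ 4 = log k ^ 2 := by
    rw [show (4 : ℕ) = 2 * 2 from rfl, pow_mul, sq_sqrt (log_nonneg hk)]
  have h2 : (k ^ (1 / 4 : ℝ)) ^ 4 = k := by
    rw [← rpow_natCast, ← rpow_mul (by linarith)]
    norm_num
  rw [div_pow, h1, h2]

theorem exp_half_log_le {k x : ℝ} (hk : 0 < k) (hx : exp (-(log k / 4)) ≤ x) :
    exp (log k / 2) ≤ k * x ^ 2 := by
  calc exp (log k / 2) = exp (log k) * exp (-(log k / 4)) ^ 2 := by
        rw [← exp_nat_mul, ← exp_add]; congr 1; push_cast; ring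
    _ ≤ k * x ^ 2 := by rw [exp_log hk]; gcongr

theorem le_exp_half_of_affine {a ω : ℝ} (h : (a * ω ^ 2 + 0) * exp (-(1 / 2 * ω)) ≤ 1) :
    a * ω ^ 2 ≤ exp (ω / 2) := by
  rw [exp_neg, mul_inv_le_iff₀ (exp_pos _), one_mul, add_zero] at h
  rwa [show ω / 2 = 1 / 2 * ω by ring]

theorem asymptotic_lower_bound {ζ : ℝ} (hζ : 0 < ζ) :
    ∃ d : ℝ, 0 < d ∧ ∃ K : ℕ, ∃ t : ℝ, 0 < t ∧ ∀ k : ℕ, 2 ≤ k → ∀ ε : ℝ, 0 < ε → ε < 1 / 2 →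
      log (1 / ε) / log k < d → K ≤ k → (√(log k) / (k : ℝ) ^ (1 / 4 : ℝ)) / (1 - 2 * ε) < t →
      (1 - ζ) * ((k : ℝ) / (2 * exp 1 ^ 2 * log k) * log (1 / (2 * ε)) ^ 2) ≤
        sampleComplexity k ε := by
  obtain ⟨η, ρ, hη, hη1, hρ, hS, hρ'⟩ := exists_rho hζ
  obtain ⟨ω₀, hω₀, hmain⟩ := exists_le_sampleComplexity hη hη1 one_pos hη.le hρ hS
  have hη2 : 0 < 1 - η := by linarith
  set A := η + 2 / (1 - η) with hA
  have hA0 : 0 < A := by positivity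
  -- 1280 · 4 · (2A log k)² = 20480 A² log²k, so τ⁴ ≤ t₀ is the requirement for 2ε ≥ 1/2.
  set t₀ := η ^ 2 / (20480 * A ^ 2) with ht₀
  have ht₀0 : 0 < t₀ := by positivity
  have hev : ∀ᶠ k : ℕ in atTop, (81920 * A ^ 2 / η ^ 2 * log k ^ 2 + 0) *
      exp (-(1 / 2 * log k)) ≤ 1 :=
    tendsto_log_natCast.eventually (eventually_affine_mul_exp_le (by norm_num) one_pos 2)
  obtain ⟨K, hK⟩ := eventually_atTop.1 (hev.and
    ((tendsto_log_natCast.eventually_ge_atTop ω₀).and (tendsto_log_natCast.eventually_ge_atTop 1)))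
  -- δ < η gives log(1/(2ε)) ≤ η log k, as κ = η requires. δ < 1/4 gives k(2ε)² ≥ √k, which beats
  -- log²k when 2ε < 1/2.
  refine ⟨min η (1 / 4), by positivity, K, min 1 t₀, by positivity, ?_⟩
  intro k hk2 ε hε hε1 hδ hKk hτ
  obtain ⟨hev, hω, hω1⟩ := hK k hKk
  have hω0 : 0 < log k := by linarith
  have hk1 : (1 : ℝ) ≤ k := by exact_mod_cast (by omega : 1 ≤ k)
  have hk0 : (0 : ℝ) < k := by linarith
  have hx : 0 < 2 * ε := by linarith
  have hx2 : 0 < 1 - 2 * ε := by linarith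
  rw [div_lt_iff₀ hω0] at hδ
  have hℓε : log (1 / (2 * ε)) ≤ log (1 / ε) := by
    refine log_le_log (by positivity) ?_
    exact one_div_le_one_div_of_le hε (by linarith)
  have hℓη : log (1 / (2 * ε)) ≤ η * log k := by
    have : min η (1 / 4) * log k ≤ η * log k := by gcongr; exact min_le_left _ _
    linarith
  have hεk : exp (-(log k / 4)) ≤ 2 * ε := by
    have h1 : min η (1 / 4) * log k ≤ 1 / 4 * log k := by gcongr; exact min_le_right _ _
    rw [one_div, log_inv] at hδ
    have h2 : -(log k / 4) ≤ log ε := by linarith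
    have h3 := exp_le_exp.2 h2
    rw [exp_log hε] at h3
    linarith
  have hL : (⌈1 * log k⌉₊ : ℝ) ≤ 2 * log k := by
    have := Nat.ceil_lt_add_one (by linarith : 0 ≤ 1 * log (k : ℝ))
    linarith
  have hkey := hmain k hω ε hε hε1 (by linarith) A
    (by
      have : 2 / (1 - η) * (⌈1 * log k⌉₊ : ℝ) ≤ 2 / (1 - η) * (2 * log k) := by gcongr
      have h2 : 0 ≤ η * log k := by positivity
      have e : A * (2 * 1 * log k) = 2 * (η * log k) + 2 / (1 - η) * (2 * log k) := by
        rw [hA]; ring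
      rw [e]
      linarith)
    (key_of_cases hk0 hη hx (by linarith) (fun _ => by
      have h1 : ((√(log k) / (k : ℝ) ^ (1 / 4 : ℝ)) / (1 - 2 * ε)) ^ 4 ≤ t₀ := by
        calc _ ≤ (min 1 t₀) ^ 4 := by gcongr
          _ ≤ min 1 t₀ := pow_le_of_le_one (by positivity) (min_le_left _ _) (by norm_num)
          _ ≤ t₀ := min_le_right _ _
      rw [div_pow, sqrt_log_div_pow_four hk1, div_div, div_le_iff₀ (by positivity), ht₀,
        div_mul_eq_mul_div, le_div_iff₀ (by positivity)] at h1
      linarith) (fun _ => by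
      have h1 := le_exp_half_of_affine hev
      have h2 := exp_half_log_le hk0 hεk
      have h3 := h1.trans h2
      rw [div_mul_eq_mul_div, div_le_iff₀ (by positivity)] at h3
      linarith))
  refine le_trans ?_ hkey
  have e : (1 - ζ) * ((k : ℝ) / (2 * exp 1 ^ 2 * log k) * log (1 / (2 * ε)) ^ 2) =
      (1 - ζ) * (1 / (2 * exp 1 ^ 2)) * (k / log k) * log (1 / (2 * ε)) ^ 2 := by
    field_simp
  rw [e]
  gcongr

/-- For small c' the variance condition near ε = 1/2 forces b down, so fewer moments are matched: γ
= c'²/400 leaves 3.2 c'⁴ log²k to be compared with 4 c'⁴ log²k. The price is a smaller ρ. -/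
theorem uniform_lower_bound {c' : ℝ} (hc' : 0 < c') :
    ∃ ρ : ℝ, 0 < ρ ∧ ∃ K : ℕ, ∀ k : ℕ, K ≤ k → ∀ ε : ℝ, exp (-(log k / 8)) ≤ ε →
      ε ≤ 1 / 2 - c' * (√(log k) / (k : ℝ) ^ (1 / 4 : ℝ)) →
      ρ * (k / log k) * log (1 / (2 * ε)) ^ 2 ≤ sampleComplexity k ε := by
  set γ := c' ^ 2 / 400 with hγ
  have hγ0 : 0 < γ := by positivity
  set κ := 1 / (8 * γ) with hκ
  have hκ0 : 0 < κ := by positivity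
  set ρ := 2 / exp 1 * exp (-((1 + 1 / 2) / γ)) /
    ((1 + 1 / 2) ^ 3 * γ * (2 / (1 - 1 / 2) + κ) ^ 2) with hρ
  have hρ0 : 0 < ρ := by
    have : (0 : ℝ) < 2 / (1 - 1 / 2) := by norm_num
    positivity
  obtain ⟨ω₀, hω₀, hmain⟩ := exists_le_sampleComplexity (η := 1 / 2) (by norm_num) (by norm_num)
    hγ0 hκ0.le hρ0 (le_of_eq (by
      have : (0 : ℝ) < 2 / (1 - 1 / 2) := by norm_num
      have h2 : 0 < 2 / (1 - 1 / 2) + κ := by linarith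
      rw [hρ]; field_simp))
  have hev : ∀ᶠ k : ℕ in atTop, (327680 * (κ + 4) ^ 2 * γ ^ 2 * log k ^ 2 + 0) *
      exp (-(1 / 2 * log k)) ≤ 1 :=
    tendsto_log_natCast.eventually (eventually_affine_mul_exp_le (by norm_num) one_pos 2)
  obtain ⟨K, hK⟩ := eventually_atTop.1 (hev.and ((tendsto_log_natCast.eventually_ge_atTop ω₀).and
    ((tendsto_log_natCast.eventually_ge_atTop (1 / γ)).and (eventually_ge_atTop 2))))
  refine ⟨ρ, hρ0, K, fun k hKk ε hε1 hε2 => ?_⟩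
  obtain ⟨hev, hω, hω1, hk2⟩ := hK k hKk
  have hω0 : 0 < log k := by linarith
  have hk1 : (1 : ℝ) ≤ k := by exact_mod_cast (by omega : 1 ≤ k)
  have hk0 : (0 : ℝ) < k := by linarith
  have hγω : 1 ≤ γ * log k := by rw [div_le_iff₀ hγ0] at hω1; linarith
  have hε0 : 0 < ε := lt_of_lt_of_le (exp_pos _) hε1
  have hτ : 0 < √(log k) / (k : ℝ) ^ (1 / 4 : ℝ) := by
    have := sqrt_pos.2 hω0
    positivity
  have hcτ : 0 < c' * (√(log k) / (k : ℝ) ^ (1 / 4 : ℝ)) := mul_pos hc' hτ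
  have hεlt : ε < 1 / 2 := by linarith
  have hx : 0 < 2 * ε := by linarith
  have hx2 : 0 < 1 - 2 * ε := by linarith
  have hlogε : log (1 / (2 * ε)) ≤ log k / 8 := by
    have h1 : log (1 / (2 * ε)) ≤ log (1 / ε) :=
      log_le_log (by positivity) (one_div_le_one_div_of_le hε0 (by linarith))
    have h2 : -(log k / 8) ≤ log ε := by
      rw [← log_exp (-(log k / 8))]; exact log_le_log (exp_pos _) hε1
    rw [one_div ε, log_inv] at h1
    linarith
  have hκγ : κ * γ * log k = log k / 8 := by rw [hκ]; field_simp
  have hL : (⌈γ * log k⌉₊ : ℝ) ≤ 2 * γ * log k := by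
    have := Nat.ceil_lt_add_one (by positivity : 0 ≤ γ * log (k : ℝ))
    linarith
  have h4 : (2 : ℝ) / (1 - 1 / 2) = 4 := by norm_num
  rcases le_or_gt (1 / 2) (2 * ε) with hcase | hcase
  · refine hmain k hω ε hε0 hεlt (by linarith) 5 ?_ (key_of_cases hk0 (by norm_num) hx (by linarith)
      (fun _ => ?_) (fun h => absurd hcase (not_le.2 h)))
    · have h1 : log (1 / (2 * ε)) ≤ 1 := by
        have h3 := log_le_sub_one_of_pos (by positivity : 0 < 1 / (2 * ε))
        have h5 : 1 / (2 * ε) ≤ 2 := by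
          rw [div_le_iff₀ hx]; linarith
        linarith
      rw [h4]
      linarith
    · have h1 : (2 * (c' * (√(log k) / (k : ℝ) ^ (1 / 4 : ℝ)))) ^ 4 ≤ (1 - 2 * ε) ^ 4 := by
        gcongr
        linarith
      have h2 : (2 * (c' * (√(log k) / (k : ℝ) ^ (1 / 4 : ℝ)))) ^ 4 =
          16 * c' ^ 4 * (log k ^ 2 / k) := by
        rw [← sqrt_log_div_pow_four hk1]; ring
      rw [h2, mul_div_assoc', div_le_iff₀ hk0] at h1
      have h3 : 1280 * (5 * (2 * γ * log k)) ^ 2 * 4 = 3.2 * (c' ^ 4 * log k ^ 2) := by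
        rw [hγ]; ring
      rw [h3]
      have h5 : 0 ≤ c' ^ 4 * log k ^ 2 := by positivity
      linarith
  · refine hmain k hω ε hε0 hεlt (by linarith) (κ + 4) ?_ (key_of_cases hk0 (by norm_num) hx
      (by linarith) (fun h => absurd hcase (not_lt.2 h)) (fun _ => ?_))
    · rw [h4]
      have e : (κ + 4) * (2 * γ * log k) = 2 * (κ * γ * log k) + 4 * (2 * γ * log k) := by ring
      rw [e, hκγ]
      linarith
    · have h1 := le_exp_half_of_affine hev
      have h2 := exp_half_log_le (x := 2 * ε) hk0 (by
        have : exp (-(log (k : ℝ) / 4)) ≤ exp (-(log k / 8)) := by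
          rw [exp_le_exp]; linarith
        linarith)
      have h3 := h1.trans h2
      have e : 1280 * ((κ + 4) * (2 * γ * log k)) ^ 2 * 16 =
        (327680 * (κ + 4) ^ 2 * γ ^ 2 * log k ^ 2) / 4 := by ring
      rw [e]
      linarith

theorem tendsto_sqrt_log_div_rpow :
    Tendsto (fun k : ℕ => √(log k) / (k : ℝ) ^ (1 / 4 : ℝ)) atTop (𝓝 0) := by
  have h : Tendsto (fun k : ℕ => log (k : ℝ) / (k : ℝ) ^ (1 / 4 : ℝ)) atTop (𝓝 0) :=
    (isLittleO_log_rpow_atTop (by norm_num : (0 : ℝ) < 1 / 4)).tendsto_div_nhds_zero.comp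
      tendsto_natCast_atTop_atTop
  refine squeeze_zero' (Eventually.of_forall fun k => by positivity) ?_ h
  filter_upwards [tendsto_log_natCast.eventually_ge_atTop 1] with k hk
  gcongr
  rw [sqrt_le_left (by linarith)]
  nlinarith

/-- Only ε < k^(-1/8) is new. There log(1/(2ε)) ≤ c log k, while at k^(-1/8) this logarithm is at
least (log k)/16, so monotonicity in ε costs at most the factor 256c². -/
theorem polynomial_lower_bound {c c' : ℝ} (hc : 0 < c) (hc' : 0 < c') :
    ∃ C : ℝ, 0 < C ∧ ∃ K : ℕ, ∀ k : ℕ, K ≤ k → ∀ ε : ℝ, 1 / (k : ℝ) ^ c ≤ ε →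
      ε ≤ 1 / 2 - c' * (√(log k) / (k : ℝ) ^ (1 / 4 : ℝ)) →
      C * ((k : ℝ) / log k) * log (1 / (2 * ε)) ^ 2 ≤ sampleComplexity k ε := by
  obtain ⟨ρ, hρ, K, hK⟩ := uniform_lower_bound hc'
  have h1 : ∀ᶠ k : ℕ in atTop, c' * (√(log k) / (k : ℝ) ^ (1 / 4 : ℝ)) ≤ 1 / 4 := by
    have := tendsto_sqrt_log_div_rpow.const_mul c'
    rw [mul_zero] at this
    exact this.eventually_le_const (by norm_num)
  obtain ⟨K', hK'⟩ := eventually_atTop.1 (h1.and ((tendsto_log_natCast.eventually_ge_atTop 16).and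
    (eventually_ge_atTop 2)))
  refine ⟨min ρ (ρ / (256 * c ^ 2)), by positivity, max K K', fun k hk ε hε1 hε2 => ?_⟩
  obtain ⟨h4, hω, hk2⟩ := hK' k ((le_max_right _ _).trans hk)
  have hKk := hK k ((le_max_left _ _).trans hk)
  have hω0 : 0 < log k := by linarith
  have hk0 : (0 : ℝ) < k := by exact_mod_cast (by omega : 0 < k)
  have hε0 : 0 < ε := lt_of_lt_of_le (by positivity) hε1
  have hτ : 0 ≤ c' * (√(log k) / (k : ℝ) ^ (1 / 4 : ℝ)) := by positivity
  rcases le_or_gt (exp (-(log k / 8))) ε with hcase | hcase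
  · refine le_trans ?_ (hKk ε hcase hε2)
    gcongr
    exact min_le_left _ _
  · have hexp : exp (-(log (k : ℝ) / 8)) ≤ 1 / 4 := by
      have e := add_one_le_exp (1 : ℝ)
      have h5 : exp (-(log (k : ℝ) / 8)) ≤ exp (-2) := by rw [exp_le_exp]; linarith
      have h6 : (4 : ℝ) ≤ exp 2 := by
        have : exp (2 : ℝ) = exp 1 ^ 2 := by rw [← exp_nat_mul]; norm_num
        rw [this]; nlinarith
      rw [exp_neg 2] at h5
      refine h5.trans ?_
      rw [one_div]
      exact inv_anti₀ (by norm_num) h6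
    have hlow := hKk (exp (-(log k / 8))) le_rfl (by linarith)
    have hmono : (sampleComplexity k (exp (-(log k / 8))) : ℝ) ≤ sampleComplexity k ε := by
      exact_mod_cast sampleComplexity_antitone (by omega) hε0 hcase.le
    refine le_trans ?_ (hlow.trans hmono)
    have hl1 : log k / 16 ≤ log (1 / (2 * exp (-(log k / 8)))) := by
      rw [one_div, log_inv, log_mul two_ne_zero (exp_pos _).ne', log_exp]
      linarith [log_two_lt_d9]
    have hl2 : log (1 / (2 * ε)) ≤ c * log k := by
      have h5 : log (1 / (2 * ε)) ≤ log (1 / ε) :=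
        log_le_log (by positivity) (one_div_le_one_div_of_le hε0 (by linarith))
      have h6 := log_le_log (by positivity) hε1
      rw [one_div, log_inv, log_rpow hk0] at h6
      rw [one_div ε, log_inv] at h5
      linarith
    have hl3 : 0 ≤ log (1 / (2 * ε)) := by
      refine log_nonneg ?_
      rw [le_div_iff₀ (by positivity)]
      linarith
    calc min ρ (ρ / (256 * c ^ 2)) * ((k : ℝ) / log k) * log (1 / (2 * ε)) ^ 2
        ≤ ρ / (256 * c ^ 2) * ((k : ℝ) / log k) * (c * log k) ^ 2 := by
          gcongr
          exact min_le_right _ _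
      _ = ρ * ((k : ℝ) / log k) * (log k / 16) ^ 2 := by field_simp; norm_num
      _ ≤ _ := by gcongr

end MainBounds
end SupportSize

/-! ### Assembly of both statements -/

theorem mainTheorem3 :
    (∃ (oδ : ℝ → ℝ) (ok : ℕ → ℝ) (oτ : ℝ → ℝ),
      Tendsto oδ (𝓝[>] 0) (𝓝 0) ∧ Tendsto ok atTop (𝓝 0) ∧ Tendsto oτ (𝓝[>] 0) (𝓝 0) ∧
      ∀ k : ℕ, 2 ≤ k → ∀ ε : ℝ, 0 < ε → ε < 1 / 2 →
        (1 - oδ (Real.log (1 / ε) / Real.log k) - ok k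
            - oτ ((√(Real.log k) / (k : ℝ) ^ (1 / 4 : ℝ)) / (1 - 2 * ε)))
          * ((k : ℝ) / (2 * Real.exp 1 ^ 2 * Real.log k)) * Real.log (1 / (2 * ε)) ^ 2
        ≤ (SupportSize.sampleComplexity k ε : ℝ)) ∧
    (∀ c c' : ℝ, 0 < c → 0 < c' → ∃ C : ℝ, 0 < C ∧ ∃ K : ℕ, ∀ k : ℕ, K ≤ k → ∀ ε : ℝ,
        1 / (k : ℝ) ^ c ≤ ε → ε ≤ 1 / 2 - c' * (√(Real.log k) / (k : ℝ) ^ (1 / 4 : ℝ)) →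
        C * ((k : ℝ) / Real.log k) * Real.log (1 / (2 * ε)) ^ 2
        ≤ (SupportSize.sampleComplexity k ε : ℝ)) := by
  refine ⟨?_, fun c c' hc hc' => SupportSize.polynomial_lower_bound hc hc'⟩
  set W : ℕ → ℝ → ℝ := fun k ε =>
    (k : ℝ) / (2 * Real.exp 1 ^ 2 * Real.log k) * Real.log (1 / (2 * ε)) ^ 2 with hW
  have hWpos : ∀ k : ℕ, 2 ≤ k → ∀ ε : ℝ, 0 < ε → ε < 1 / 2 → 0 < W k ε := by
    intro k hk ε hε hε1
    have hk1 : (1 : ℝ) < k := by exact_mod_cast (by omega : 1 < k)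
    have h1 := Real.log_pos hk1
    have h2 : 0 < Real.log (1 / (2 * ε)) := by
      refine Real.log_pos ?_
      rw [lt_div_iff₀ (by positivity)]
      linarith
    simp only [hW]
    positivity
  obtain ⟨oδ, ok, oτ, h1, h2, h3, h4⟩ := SupportSize.exists_rates
    (ι := {i : ℕ × ℝ // 2 ≤ i.1 ∧ 0 < i.2 ∧ i.2 < 1 / 2})
    (δ := fun i => Real.log (1 / i.1.2) / Real.log i.1.1) (κ := fun i => i.1.1)
    (τ := fun i => (√(Real.log i.1.1) / (i.1.1 : ℝ) ^ (1 / 4 : ℝ)) / (1 - 2 * i.1.2))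
    -- The relative deficit below the target `W`, at most 1 because the sample complexity is
    -- nonnegative.
    (e := fun i => 1 - SupportSize.sampleComplexity i.1.1 i.1.2 / W i.1.1 i.1.2)
    (fun i => by
      have := hWpos i.1.1 i.2.1 i.1.2 i.2.2.1 i.2.2.2
      have : 0 ≤ (SupportSize.sampleComplexity i.1.1 i.1.2 : ℝ) / W i.1.1 i.1.2 := by positivity
      linarith)
    (fun ζ hζ => by
      obtain ⟨d, hd, K, t, ht, h⟩ := SupportSize.asymptotic_lower_bound hζ
      refine ⟨d, hd, K, t, ht, fun i hi1 hi2 hi3 => ?_⟩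
      have hpos := hWpos i.1.1 i.2.1 i.1.2 i.2.2.1 i.2.2.2
      have := h i.1.1 i.2.1 i.1.2 i.2.2.1 i.2.2.2 hi1 hi2 hi3
      rw [sub_le_comm, le_div_iff₀ hpos]
      exact this)
  refine ⟨oδ, ok, oτ, h1, h2, h3, fun k hk ε hε hε1 => ?_⟩
  have hpos := hWpos k hk ε hε hε1
  have h5 := h4 ⟨(k, ε), hk, hε, hε1⟩
  simp only at h5
  rw [mul_assoc, ← le_div_iff₀ hpos]
  linarith
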